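/- Let $\gamma$ be a smooth simple closed curve of length $l$ on the unit sphere of $\mathbb R^n$, with $0<l\le 2\pi$, let $\mathcal C=\{s\gamma(\theta): s\ge 0\}$ be the two dimensional cone over $\gamma$ with vertex $0$ ($\theta$ being arc length on $\gamma$), and let $\mathcal C_r$ be its intersection with the open ball of radius $r$ centered at $0$. In the polar coordinates $(r,\theta)$ the surface $\mathcal C\setminus\{0\}$ carries the flat metric $dr^2+r^2d\theta^2$, with area form $r\,dr\,d\theta$. A function $u$ on $\mathcal C_1$ is called subharmonic if $\Delta u\ge 0$ in the sense of distributions on $\mathcal C_1\setminus\{0\}$ and $u$ has the mean value property of subharmonic functions at the vertex, that is, $u(0)\le \frac{1}{|\mathcal C_\rho|}\int_{\mathcal C_\rho}u$ for all $0<\rho<1$, where $|\mathcal C_\rho|=l\rho^2/2$. Let $u_+,u_-$ be nonnegative continuous subharmonic functions on $\mathcal C_1$ with $u_+u_-=0$ in $\mathcal C_1$, and let $0<\alpha\le 4\pi/l$. Then $u_\pm$ have a weak gradient $Du_\pm$ on $\mathcal C_1\setminus\{0\}$ (tangential to the cone) with $\int_{\mathcal C_r}|Du_\pm|^2<\infty$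 for every $0<r<1$, and the function $$r\mapsto \Phi(r,u_+,u_-)=\frac{1}{r^{2\alpha}}\int_{\mathcal C_r}|Du_+|^2\int_{\mathcal C_r}|Du_-|^2$$ is nondecreasing for $0<r<1$. -/

import Mathlib

open MeasureTheory Set
open scoped ContDiff

noncomputable section

namespace ConeACF

/-- `γ` is the arc length parametrization, extended periodically, of a smooth simple closed curve
of length `l` on the unit sphere of `ℝⁿ`. -/
structure IsConeGenerator {n : ℕ} (γ : ℝ → EuclideanSpace ℝ (Fin n)) (l : ℝ) : Prop where
  length_pos : 0 < l
  smooth : ContDiff ℝ ∞ γ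
  norm_eq_one : ∀ θ, ‖γ θ‖ = 1
  unit_speed : ∀ θ, ‖deriv γ θ‖ = 1
  periodic : Function.Periodic γ l
  simple : InjOn γ (Ico 0 l)

/-- The part `𝒞_R` in the open ball of radius `R` of the cone with vertex `0` over the curve `γ`. -/
def coneBall {n : ℕ} (γ : ℝ → EuclideanSpace ℝ (Fin n)) (R : ℝ) :
    Set (EuclideanSpace ℝ (Fin n)) :=
  {x | ∃ r θ : ℝ, 0 ≤ r ∧ x = r • γ θ} ∩ Metric.ball 0 R

/-- A function on the cone, read in the polar coordinates `(r, θ)` of the universal covering of the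
cone minus its vertex. Since `∂_r (r γ) = γ` and `∂_θ (r γ) = r γ'` are orthogonal, of lengths `1`
and `r`, the metric is the flat one `dr² + r² dθ²`. -/
def polar {n : ℕ} (γ : ℝ → EuclideanSpace ℝ (Fin n)) (u : EuclideanSpace ℝ (Fin n) → ℝ) :
    ℝ × ℝ → ℝ :=
  fun z => u (z.1 • γ z.2)

/-- The preimage of `𝒞_1 ∖ {0}` in the universal covering: `0 < r < 1`, `θ ∈ ℝ`. -/
def unitCover : Set (ℝ × ℝ) := Ioo 0 1 ×ˢ univ

/-- A fundamental domain of `𝒞_R ∖ {0}` for a cone of length `l`: `0 < r < R`, `0 < θ ≤ l`. -/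
def sector (l R : ℝ) : Set (ℝ × ℝ) := Ioo 0 R ×ˢ Ioc 0 l

/-- The integral over `𝒞_R` with respect to the area form `r dr dθ` of a function that is given in
polar coordinates. -/
def coneIntegral (l R : ℝ) (f : ℝ × ℝ → ℝ) : ℝ := ∫ z in sector l R, f z * z.1

/-- The partial derivative in `r`. -/
def dr (φ : ℝ × ℝ → ℝ) (z : ℝ × ℝ) : ℝ := fderiv ℝ φ z (1, 0)

/-- The partial derivative in `θ`. -/
def dθ (φ : ℝ × ℝ → ℝ) (z : ℝ × ℝ) : ℝ := fderiv ℝ φ z (0, 1)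

/-- The Laplacian of the flat metric in polar coordinates. -/
def polarLaplacian (φ : ℝ × ℝ → ℝ) (z : ℝ × ℝ) : ℝ :=
  dr (dr φ) z + dr φ z / z.1 + dθ (dθ φ) z / z.1 ^ 2

/-- Test functions: smooth, with compact support in the covering of `𝒞_1 ∖ {0}`. -/
structure IsTest (φ : ℝ × ℝ → ℝ) : Prop where
  smooth : ContDiff ℝ ∞ φ
  compact : HasCompactSupport φ
  support_subset : tsupport φ ⊆ unitCover

/-- `u` is subharmonic on `𝒞_1`: away from the vertex `Δ u ≥ 0` in the sense of distributions (this
is local, so it is tested on the covering, which is locally isometric to the cone), and at the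
vertex `u` has the mean value property of subharmonic functions (`𝒞_ρ` has area `l ρ² / 2`). -/
structure IsSubharmonic {n : ℕ} (γ : ℝ → EuclideanSpace ℝ (Fin n)) (l : ℝ)
    (u : EuclideanSpace ℝ (Fin n) → ℝ) : Prop where
  locallyIntegrable : LocallyIntegrableOn (polar γ u) unitCover
  laplacian_nonneg : ∀ φ : ℝ × ℝ → ℝ, IsTest φ → (∀ z, 0 ≤ φ z) →
    0 ≤ ∫ z, polar γ u z * polarLaplacian φ z * z.1
  integrable_vertex : ∀ ρ ∈ Ioo (0 : ℝ) 1, IntegrableOn (fun z => polar γ u z * z.1) (sector l ρ)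
  mean_value_vertex : ∀ ρ ∈ Ioo (0 : ℝ) 1,
    u 0 ≤ coneIntegral l ρ (polar γ u) / (l * ρ ^ 2 / 2)

/-- `G = (G₁, G₂)` is the pair of weak partial derivatives `(∂_r U, ∂_θ U)` of `U` for
`0 < r < 1`. -/
structure HasWeakPartials (U : ℝ × ℝ → ℝ) (G : ℝ × ℝ → ℝ × ℝ) : Prop where
  locallyIntegrable : LocallyIntegrableOn G unitCover
  radial : ∀ φ : ℝ × ℝ → ℝ, IsTest φ → ∫ z, U z * dr φ z = -∫ z, (G z).1 * φ z
  angular : ∀ φ : ℝ × ℝ → ℝ, IsTest φ → ∫ z, U z * dθ φ z = -∫ z, (G z).2 * φ z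

/-- `U` has locally integrable weak partial derivatives for `0 < r < 1`. -/
def WeaklyDifferentiable (U : ℝ × ℝ → ℝ) : Prop := ∃ G, HasWeakPartials U G

open Classical in
/-- The weak partial derivatives `(∂_r U, ∂_θ U)`, unique up to a null set; `0` if there are
none. -/
def weakPartials (U : ℝ × ℝ → ℝ) : ℝ × ℝ → ℝ × ℝ :=
  if h : WeaklyDifferentiable U then h.choose else 0

/-- `|Du|² = (∂_r u)² + r⁻² (∂_θ u)²`, the squared length of the tangential gradient, in polar
coordinates. -/
def gradSq {n : ℕ} (γ : ℝ → EuclideanSpace ℝ (Fin n)) (u : EuclideanSpace ℝ (Fin n) → ℝ)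
    (z : ℝ × ℝ) : ℝ :=
  (weakPartials (polar γ u) z).1 ^ 2 + (weakPartials (polar γ u) z).2 ^ 2 / z.1 ^ 2

/-- `u` is weakly differentiable with `∫_{𝒞_r} |Du|² < ∞` for all `0 < r < 1`. -/
def HasLocallyFiniteEnergy {n : ℕ} (γ : ℝ → EuclideanSpace ℝ (Fin n)) (l : ℝ)
    (u : EuclideanSpace ℝ (Fin n) → ℝ) : Prop :=
  WeaklyDifferentiable (polar γ u) ∧
    ∀ r ∈ Ioo (0 : ℝ) 1, IntegrableOn (fun z => gradSq γ u z * z.1) (sector l r)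

/-- `Φ(r, u, v) = r^{-2α} ∫_{𝒞_r} |Du|² ∫_{𝒞_r} |Dv|²`. -/
def acf {n : ℕ} (γ : ℝ → EuclideanSpace ℝ (Fin n)) (l α : ℝ)
    (u v : EuclideanSpace ℝ (Fin n) → ℝ) (r : ℝ) : ℝ :=
  1 / r ^ (2 * α) * coneIntegral l r (gradSq γ u) * coneIntegral l r (gradSq γ v)

end ConeACF

end

namespace ConeACF

/-! ### Partial derivatives in the plane -/

/-! In the variable `t = log r` the cone minus its vertex becomes a half cylinder of circumference
`l`. The change of variables is conformal, so it preserves Dirichlet integrals and subharmonicity.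
If `E₊(t)`, `E₋(t)` are the energies of the two functions below height `t`, then `Φ(eᵗ) = e^{-2αt}
E₊ E₋`, and the claim is `E₊'/E₊ + E₋'/E₋ ≥ 2α` where both energies are positive.

For a smooth nonnegative subharmonic `f`, `Δ(f²/2) ≥ |∇f|²`; hence the slice integral of `f²/2` is
convex in `t`. Being bounded as `t → -∞`, it is also nondecreasing, and integration gives `E ≤ ∫ f
f_t` over the slice (`energy_le_flux`). If `f` vanishes somewhere on the slice and is nonzero on a
set of length `a`, Wirtinger's inequality `∫ f² ≤ (a/π)² ∫ f_θ²` (`integral_sq_le_of_support`)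
yields `E ≤ (a/2π) E'`. Disjoint supports have lengths with `a + b ≤ l`, so the sum of the
logarithmic derivatives is at least `2π(1/a + 1/b) ≥ 8π/l ≥ 2α` (`slice_product_inequality`).

Continuous functions are mollified and then composed with a convex nondecreasing function that is
flat near `0`, which keeps both subharmonicity and the disjointness of supports
(`IsModel.exists_approx`). The convexity argument applied to the difference of two approximants
shows that their gradients are Cauchy in `L²` (`IsApprox.energy_sub_le`). The limit is the weak
gradient, the energies converge (`tendsto_energy`), and monotonicity passes to the limit. -/

theorem contDiff_dr {φ : ℝ × ℝ → ℝ} (hφ : ContDiff ℝ ∞ φ) : ContDiff ℝ ∞ (dr φ) :=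
  (hφ.fderiv_right (m := ∞) (by simp)).clm_apply contDiff_const

theorem contDiff_dθ {φ : ℝ × ℝ → ℝ} (hφ : ContDiff ℝ ∞ φ) : ContDiff ℝ ∞ (dθ φ) :=
  (hφ.fderiv_right (m := ∞) (by simp)).clm_apply contDiff_const

theorem hasDerivAt_fst_slice {φ : ℝ × ℝ → ℝ} {t θ : ℝ} (hφ : DifferentiableAt ℝ φ (t, θ)) :
    HasDerivAt (fun s => φ (s, θ)) (dr φ (t, θ)) t := by
  have h : HasDerivAt (fun s : ℝ => (s, θ)) ((1 : ℝ), (0 : ℝ)) t :=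
    (hasDerivAt_id t).prodMk (hasDerivAt_const t θ)
  exact hφ.hasFDerivAt.comp_hasDerivAt t h

theorem hasDerivAt_snd_slice {φ : ℝ × ℝ → ℝ} {t θ : ℝ} (hφ : DifferentiableAt ℝ φ (t, θ)) :
    HasDerivAt (fun s => φ (t, s)) (dθ φ (t, θ)) θ := by
  have h : HasDerivAt (fun s : ℝ => (t, s)) ((0 : ℝ), (1 : ℝ)) θ :=
    (hasDerivAt_const θ t).prodMk (hasDerivAt_id θ)
  exact hφ.hasFDerivAt.comp_hasDerivAt θ h

theorem dr_eq_of_hasDerivAt {φ : ℝ × ℝ → ℝ} {t θ d : ℝ} (hφ : DifferentiableAt ℝ φ (t, θ))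
    (h : HasDerivAt (fun s => φ (s, θ)) d t) : dr φ (t, θ) = d :=
  (hasDerivAt_fst_slice hφ).unique h

theorem dθ_eq_of_hasDerivAt {φ : ℝ × ℝ → ℝ} {t θ d : ℝ} (hφ : DifferentiableAt ℝ φ (t, θ))
    (h : HasDerivAt (fun s => φ (t, s)) d θ) : dθ φ (t, θ) = d :=
  (hasDerivAt_snd_slice hφ).unique h

theorem ContDiff.dr_slice {φ : ℝ × ℝ → ℝ} (hφ : ContDiff ℝ ∞ φ) (t θ : ℝ) :
    HasDerivAt (fun s => φ (s, θ)) (dr φ (t, θ)) t :=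
  hasDerivAt_fst_slice (hφ.differentiable (by simp) _)

theorem ContDiff.dθ_slice {φ : ℝ × ℝ → ℝ} (hφ : ContDiff ℝ ∞ φ) (t θ : ℝ) :
    HasDerivAt (fun s => φ (t, s)) (dθ φ (t, θ)) θ :=
  hasDerivAt_snd_slice (hφ.differentiable (by simp) _)

/-- The flat Laplacian of the plane. -/
noncomputable def lap (φ : ℝ × ℝ → ℝ) (z : ℝ × ℝ) : ℝ := dr (dr φ) z + dθ (dθ φ) z

/-- The squared length of the gradient in the plane. -/
noncomputable def gsq (φ : ℝ × ℝ → ℝ) (z : ℝ × ℝ) : ℝ := dr φ z ^ 2 + dθ φ z ^ 2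

theorem gsq_nonneg (φ : ℝ × ℝ → ℝ) (z : ℝ × ℝ) : 0 ≤ gsq φ z := by unfold gsq; positivity

theorem continuous_gsq {φ : ℝ × ℝ → ℝ} (hφ : ContDiff ℝ ∞ φ) : Continuous (gsq φ) :=
  ((contDiff_dr hφ).continuous.pow 2).add ((contDiff_dθ hφ).continuous.pow 2)

theorem dr_add {φ ψ : ℝ × ℝ → ℝ} (hφ : ContDiff ℝ ∞ φ) (hψ : ContDiff ℝ ∞ ψ) :
    dr (fun z => φ z + ψ z) = fun z => dr φ z + dr ψ z := by
  ext ⟨t, θ⟩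
  exact dr_eq_of_hasDerivAt ((hφ.add hψ).differentiable (by simp) _)
    ((ContDiff.dr_slice hφ t θ).add (ContDiff.dr_slice hψ t θ))

theorem dθ_add {φ ψ : ℝ × ℝ → ℝ} (hφ : ContDiff ℝ ∞ φ) (hψ : ContDiff ℝ ∞ ψ) :
    dθ (fun z => φ z + ψ z) = fun z => dθ φ z + dθ ψ z := by
  ext ⟨t, θ⟩
  exact dθ_eq_of_hasDerivAt ((hφ.add hψ).differentiable (by simp) _)
    ((ContDiff.dθ_slice hφ t θ).add (ContDiff.dθ_slice hψ t θ))

theorem dr_mul {φ ψ : ℝ × ℝ → ℝ} (hφ : ContDiff ℝ ∞ φ) (hψ : ContDiff ℝ ∞ ψ) :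
    dr (fun z => φ z * ψ z) = fun z => dr φ z * ψ z + φ z * dr ψ z := by
  ext ⟨t, θ⟩
  exact dr_eq_of_hasDerivAt ((hφ.mul hψ).differentiable (by simp) _)
    ((ContDiff.dr_slice hφ t θ).mul (ContDiff.dr_slice hψ t θ))

theorem dθ_mul {φ ψ : ℝ × ℝ → ℝ} (hφ : ContDiff ℝ ∞ φ) (hψ : ContDiff ℝ ∞ ψ) :
    dθ (fun z => φ z * ψ z) = fun z => dθ φ z * ψ z + φ z * dθ ψ z := by
  ext ⟨t, θ⟩
  exact dθ_eq_of_hasDerivAt ((hφ.mul hψ).differentiable (by simp) _)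
    ((ContDiff.dθ_slice hφ t θ).mul (ContDiff.dθ_slice hψ t θ))

theorem dr_const (c : ℝ) : dr (fun _ => c) = fun _ => 0 := by
  ext z; simp [dr]

theorem dθ_const (c : ℝ) : dθ (fun _ => c) = fun _ => 0 := by
  ext z; simp [dθ]

theorem dr_comp {β : ℝ → ℝ} {φ : ℝ × ℝ → ℝ} (hβ : ContDiff ℝ ∞ β) (hφ : ContDiff ℝ ∞ φ) :
    dr (fun z => β (φ z)) = fun z => deriv β (φ z) * dr φ z := by
  ext ⟨t, θ⟩
  exact dr_eq_of_hasDerivAt ((hβ.comp hφ).differentiable (by simp) _)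
    (((hβ.differentiable (by simp) _).hasDerivAt).comp t (ContDiff.dr_slice hφ t θ))

theorem dθ_comp {β : ℝ → ℝ} {φ : ℝ × ℝ → ℝ} (hβ : ContDiff ℝ ∞ β) (hφ : ContDiff ℝ ∞ φ) :
    dθ (fun z => β (φ z)) = fun z => deriv β (φ z) * dθ φ z := by
  ext ⟨t, θ⟩
  exact dθ_eq_of_hasDerivAt ((hβ.comp hφ).differentiable (by simp) _)
    (((hβ.differentiable (by simp) _).hasDerivAt).comp θ (ContDiff.dθ_slice hφ t θ))

theorem lap_add {φ ψ : ℝ × ℝ → ℝ} (hφ : ContDiff ℝ ∞ φ) (hψ : ContDiff ℝ ∞ ψ) (z : ℝ × ℝ) :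
    lap (fun z => φ z + ψ z) z = lap φ z + lap ψ z := by
  unfold lap
  rw [dr_add hφ hψ, dθ_add hφ hψ, dr_add (contDiff_dr hφ) (contDiff_dr hψ),
    dθ_add (contDiff_dθ hφ) (contDiff_dθ hψ)]
  ring

theorem lap_const_mul {φ : ℝ × ℝ → ℝ} (c : ℝ) (hφ : ContDiff ℝ ∞ φ) (z : ℝ × ℝ) :
    lap (fun z => c * φ z) z = c * lap φ z := by
  unfold lap
  rw [dr_mul contDiff_const hφ, dθ_mul contDiff_const hφ, dr_const, dθ_const]
  simp only [zero_mul, zero_add]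
  rw [dr_mul contDiff_const (contDiff_dr hφ), dθ_mul contDiff_const (contDiff_dθ hφ), dr_const,
    dθ_const]
  ring

theorem lap_mul_self {φ : ℝ × ℝ → ℝ} (hφ : ContDiff ℝ ∞ φ) (z : ℝ × ℝ) :
    lap (fun z => φ z * φ z) z = 2 * (gsq φ z + φ z * lap φ z) := by
  have h1 := contDiff_dr hφ
  have h2 := contDiff_dθ hφ
  unfold lap gsq
  rw [dr_mul hφ hφ, dθ_mul hφ hφ, dr_add (h1.mul hφ) (hφ.mul h1), dθ_add (h2.mul hφ) (hφ.mul h2),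
    dr_mul h1 hφ, dr_mul hφ h1, dθ_mul h2 hφ, dθ_mul hφ h2]
  ring

theorem lap_comp {β : ℝ → ℝ} {φ : ℝ × ℝ → ℝ} (hβ : ContDiff ℝ ∞ β) (hφ : ContDiff ℝ ∞ φ)
    (z : ℝ × ℝ) : lap (fun z => β (φ z)) z =
      deriv (deriv β) (φ z) * gsq φ z + deriv β (φ z) * lap φ z := by
  have hβ' : ContDiff ℝ ∞ (deriv β) := (contDiff_infty_iff_deriv.1 hβ).2
  have hc : ContDiff ℝ ∞ (fun z => deriv β (φ z)) := hβ'.comp hφ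
  unfold lap gsq
  rw [dr_comp hβ hφ, dθ_comp hβ hφ, dr_mul hc (contDiff_dr hφ), dθ_mul hc (contDiff_dθ hφ),
    dr_comp hβ' hφ, dθ_comp hβ' hφ]
  ring

/-- `φ` is `L`-periodic in the second variable. -/
def SndPeriodic (L : ℝ) (φ : ℝ × ℝ → ℝ) : Prop := ∀ t θ, φ (t, θ + L) = φ (t, θ)

theorem SndPeriodic.dr {L : ℝ} {φ : ℝ × ℝ → ℝ} (hφ : ContDiff ℝ ∞ φ) (h : SndPeriodic L φ) :
    SndPeriodic L (dr φ) := fun t θ =>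
  (ContDiff.dr_slice hφ t (θ + L)).unique (by simpa only [h _ _] using ContDiff.dr_slice hφ t θ)

theorem SndPeriodic.dθ {L : ℝ} {φ : ℝ × ℝ → ℝ} (hφ : ContDiff ℝ ∞ φ) (h : SndPeriodic L φ) :
    SndPeriodic L (dθ φ) := fun t θ => by
  have h1 := (ContDiff.dθ_slice hφ t (θ + L)).comp_add_const θ L
  simp only [h _ _] at h1
  exact h1.unique (ContDiff.dθ_slice hφ t θ)

theorem SndPeriodic.nat_mul {L : ℝ} {φ : ℝ × ℝ → ℝ} (h : SndPeriodic L φ) (N : ℕ) :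
    SndPeriodic (N * L) φ := fun t θ => by
  have : Function.Periodic (fun s => φ (t, s)) L := fun s => h t s
  exact this.nat_mul N θ

/-- Differentiation under the integral sign over a compact interval. -/
theorem hasDerivAt_slice_integral {φ : ℝ × ℝ → ℝ} (hφ : ContDiff ℝ ∞ φ) (a b t : ℝ) :
    HasDerivAt (fun s => ∫ θ in a..b, φ (s, θ)) (∫ θ in a..b, dr φ (t, θ)) t := by
  have hc := (contDiff_dr hφ).continuous
  obtain ⟨C, hC⟩ := (isCompact_Icc (a := t - 1) (b := t + 1)).prod (isCompact_uIcc (a := a) (b := b))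
    |>.exists_bound_of_continuousOn hc.continuousOn
  refine (intervalIntegral.hasDerivAt_integral_of_dominated_loc_of_deriv_le
    (F := fun s θ => φ (s, θ)) (F' := fun s θ => dr φ (s, θ)) (bound := fun _ => C)
    (Icc_mem_nhds (a := t - 1) (b := t + 1) (by linarith) (by linarith)) ?_ ?_ ?_ ?_ ?_ ?_).2
  · exact Filter.Eventually.of_forall fun s =>
      (hφ.continuous.comp (by fun_prop)).aestronglyMeasurable
  · exact (hφ.continuous.comp (by fun_prop : Continuous fun θ : ℝ => (t, θ))).intervalIntegrable _ _
  · exact (hc.comp (by fun_prop : Continuous fun θ : ℝ => (t, θ))).aestronglyMeasurable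
  · exact Filter.Eventually.of_forall fun θ hθ s hs => hC (s, θ) ⟨hs, uIoc_subset_uIcc hθ⟩
  · exact intervalIntegrable_const
  · exact Filter.Eventually.of_forall fun θ _ s _ => ContDiff.dr_slice hφ s θ

theorem continuous_slice_integral {φ : ℝ × ℝ → ℝ} (hφ : Continuous φ) (a b : ℝ) :
    Continuous fun s => ∫ θ in a..b, φ (s, θ) :=
  intervalIntegral.continuous_parametric_intervalIntegral_of_continuous'
    (f := fun s θ => φ (s, θ)) hφ a b

theorem integral_dθ_eq_zero {φ : ℝ × ℝ → ℝ} {L : ℝ} (hφ : ContDiff ℝ ∞ φ) (h : SndPeriodic L φ)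
    (c t : ℝ) : ∫ θ in c..(c + L), dθ φ (t, θ) = 0 := by
  rw [intervalIntegral.integral_eq_sub_of_hasDerivAt (fun θ _ => ContDiff.dθ_slice hφ t θ)
    (((contDiff_dθ hφ).continuous.comp
      (by fun_prop : Continuous fun θ : ℝ => (t, θ))).intervalIntegrable _ _), h, sub_self]

/-- For a periodic function the second derivative of the slice integrals is the slice integral of
the Laplacian. -/
theorem hasDerivAt_slice_integral_dr {φ : ℝ × ℝ → ℝ} {L : ℝ} (hφ : ContDiff ℝ ∞ φ)
    (h : SndPeriodic L φ) (c t : ℝ) :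
    HasDerivAt (fun s => ∫ θ in c..(c + L), dr φ (s, θ)) (∫ θ in c..(c + L), lap φ (t, θ)) t := by
  have h1 := hasDerivAt_slice_integral (contDiff_dr hφ) c (c + L) t
  have hs : Continuous fun θ : ℝ => (t, θ) := by fun_prop
  have e : ∫ θ in c..(c + L), lap φ (t, θ) = ∫ θ in c..(c + L), dr (dr φ) (t, θ) := by
    unfold lap
    rw [intervalIntegral.integral_add, integral_dθ_eq_zero (contDiff_dθ hφ) (h.dθ hφ), add_zero]
    · exact ((contDiff_dr (contDiff_dr hφ)).continuous.comp hs).intervalIntegrable _ _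
    · exact ((contDiff_dθ (contDiff_dθ hφ)).continuous.comp hs).intervalIntegrable _ _
  rwa [e]

/-! ### Energy of bounded subharmonic functions on a half cylinder -/

/-- A convex function that is bounded on a half line towards `-∞` cannot decrease, and its slope at
`t` is at most its mean slope on an interval to the right of `t`. -/
theorem deriv_bounds_of_bounded_of_convex {F F₁ F₂ : ℝ → ℝ} {S B : ℝ}
    (h₁ : ∀ t, HasDerivAt F (F₁ t) t) (h₂ : ∀ t, HasDerivAt F₁ (F₂ t) t)
    (hF₂ : ∀ t < S, 0 ≤ F₂ t) (hB : ∀ t < S, |F t| ≤ B) {t : ℝ} (ht : t < S) :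
    0 ≤ F₁ t ∧ F₁ t ≤ 4 * B / (S - t) := by
  have hmono : MonotoneOn F₁ (Iio S) := by
    refine monotoneOn_of_deriv_nonneg (convex_Iio S)
      (fun t _ => (h₂ t).continuousAt.continuousWithinAt)
      (fun t _ => (h₂ t).differentiableAt.differentiableWithinAt) fun t ht => ?_
    rw [interior_Iio] at ht
    rw [(h₂ t).deriv]
    exact hF₂ t ht
  have hslope : ∀ a b : ℝ, a < b → ∃ ξ ∈ Ioo a b, F₁ ξ * (b - a) = F b - F a := by
    intro a b hab
    obtain ⟨ξ, hξ, h⟩ := exists_hasDerivAt_eq_slope F F₁ hab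
      (fun t _ => (h₁ t).continuousAt.continuousWithinAt) fun t _ => h₁ t
    refine ⟨ξ, hξ, ?_⟩
    rw [h]
    field_simp [sub_ne_zero.2 hab.ne']
  have hB0 : 0 ≤ B := (abs_nonneg _).trans (hB t ht)
  constructor
  · by_contra! hneg
    -- Going back by `x` with slope at most `F₁ t` raises `F` by at least `2B + 1`, more than its
    -- oscillation.
    set x := (2 * B + 1) / (-F₁ t) with hx
    have hxpos : 0 < x := by apply div_pos <;> linarith
    obtain ⟨ξ, hξ, h⟩ := hslope (t - x) t (by linarith)
    have h1 := hmono (show ξ < S from hξ.2.trans ht) ht hξ.2.le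
    have h2 : F₁ t * x = -(2 * B + 1) := by
      have := hneg.ne
      rw [hx, div_neg, mul_neg, mul_div_cancel₀ _ this]
    have h3 := abs_le.1 (hB t ht)
    have h4 := abs_le.1 (hB (t - x) (by linarith))
    have h5 : F₁ ξ * x ≤ F₁ t * x := by gcongr
    have h6 : F₁ ξ * (t - (t - x)) = F₁ ξ * x := by ring
    linarith
  -- The midpoint of `t` and `S` keeps `F` within its bounds; the oscillation `2B` over the length
  -- `(S - t)/2` gives `4B/(S - t)`.
  · obtain ⟨ξ, hξ, h⟩ := hslope t ((S + t) / 2) (by linarith)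
    have hs : (S + t) / 2 < S := by linarith
    have h1 := hmono ht (show ξ < S from hξ.2.trans hs) hξ.1.le
    have h3 := abs_le.1 (hB t ht)
    have h4 := abs_le.1 (hB _ hs)
    rw [le_div_iff₀ (by linarith)]
    have h5 : F₁ t * ((S + t) / 2 - t) ≤ F₁ ξ * ((S + t) / 2 - t) := by
      gcongr
      linarith
    linarith

/-- The half strip `t < S`, `c < θ ≤ c + L`. -/
def strip (c L S : ℝ) : Set (ℝ × ℝ) := Iio S ×ˢ Ioc c (c + L)

theorem measurableSet_strip (c L S : ℝ) : MeasurableSet (strip c L S) :=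
  measurableSet_Iio.prod measurableSet_Ioc

theorem volume_restrict_strip (c L S : ℝ) : (volume : Measure (ℝ × ℝ)).restrict (strip c L S) =
    (volume.restrict (Iio S)).prod (volume.restrict (Ioc c (c + L))) := by
  rw [Measure.prod_restrict]; rfl

theorem setIntegral_strip {e : ℝ × ℝ → ℝ} {c L S : ℝ} (hL : 0 ≤ L)
    (h : IntegrableOn e (strip c L S)) :
    ∫ z in strip c L S, e z = ∫ t in Iic S, ∫ θ in c..(c + L), e (t, θ) := by
  have h' := h
  rw [IntegrableOn, volume_restrict_strip] at h'
  rw [volume_restrict_strip, integral_prod _ h', integral_Iic_eq_integral_Iio]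
  simp only [intervalIntegral.integral_of_le (show c ≤ c + L by linarith)]

/-- The energy estimate: `∫ e ≤ d/dt ∫ P` over the half strip if `e ≤ ΔP`. -/
theorem energy_le_flux {P e : ℝ × ℝ → ℝ} {c L S B : ℝ} (hL : 0 < L) (hP : ContDiff ℝ ∞ P)
    (hper : SndPeriodic L P) (hB : ∀ z : ℝ × ℝ, z.1 < S → |P z| ≤ B) (he : Continuous e)
    (he0 : ∀ z, 0 ≤ e z) (hle : ∀ z : ℝ × ℝ, z.1 < S → e z ≤ lap P z) {t : ℝ} (ht : t < S) :
    IntegrableOn e (strip c L t) ∧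
    IntegrableOn (fun s => ∫ θ in c..(c + L), e (s, θ)) (Iic t) ∧
    ∫ z in strip c L t, e z ≤ ∫ θ in c..(c + L), dr P (t, θ) ∧
    ∫ θ in c..(c + L), dr P (t, θ) ≤ 4 * (B * L) / (S - t) := by
  have hcL : c ≤ c + L := by linarith
  have hslc : ∀ s : ℝ, Continuous fun θ : ℝ => (s, θ) := fun s => by fun_prop
  have hlap : Continuous (lap P) :=
    (contDiff_dr (contDiff_dr hP)).continuous.add (contDiff_dθ (contDiff_dθ hP)).continuous
  set F : ℝ → ℝ := fun s => ∫ θ in c..(c + L), P (s, θ) with hF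
  set F₁ : ℝ → ℝ := fun s => ∫ θ in c..(c + L), dr P (s, θ) with hF₁
  set F₂ : ℝ → ℝ := fun s => ∫ θ in c..(c + L), lap P (s, θ) with hF₂
  set ē : ℝ → ℝ := fun s => ∫ θ in c..(c + L), e (s, θ) with hē
  have hēc : Continuous ē := continuous_slice_integral he _ _
  have hF₂c : Continuous F₂ := continuous_slice_integral hlap _ _
  have hē0 : ∀ s, 0 ≤ ē s := fun s =>
    intervalIntegral.integral_nonneg hcL fun θ _ => he0 _
  have hēF : ∀ s < S, ē s ≤ F₂ s := fun s hs =>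
    intervalIntegral.integral_mono_on hcL ((he.comp (hslc s)).intervalIntegrable _ _)
      ((hlap.comp (hslc s)).intervalIntegrable _ _) fun θ _ => hle _ hs
  have h₁ : ∀ s, HasDerivAt F (F₁ s) s := fun s => hasDerivAt_slice_integral hP _ _ s
  have h₂ : ∀ s, HasDerivAt F₁ (F₂ s) s := fun s => hasDerivAt_slice_integral_dr hP hper c s
  have hbd : ∀ s < S, |F s| ≤ B * L := fun s hs => by
    have := intervalIntegral.norm_integral_le_of_norm_le_const (a := c) (b := c + L)
      (f := fun θ => P (s, θ)) (C := B) fun θ _ => hB _ hs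
    rwa [add_sub_cancel_left, abs_of_pos hL] at this
  have hconv := fun s hs => deriv_bounds_of_bounded_of_convex (t := s) h₁ h₂
    (fun s hs => (hē0 s).trans (hēF s hs)) hbd hs
  -- The boundary term `F₁ a` is nonnegative and drops out. The bound does not depend on `a`, so it
  -- yields integrability down to `-∞`.
  have hint : ∀ a ≤ t, ∫ s in a..t, ē s ≤ F₁ t := by
    intro a ha
    calc ∫ s in a..t, ē s ≤ ∫ s in a..t, F₂ s :=
          intervalIntegral.integral_mono_on ha (hēc.intervalIntegrable _ _)
            (hF₂c.intervalIntegrable _ _) fun s hs => hēF s (hs.2.trans_lt ht)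
      _ = F₁ t - F₁ a := intervalIntegral.integral_eq_sub_of_hasDerivAt (fun s _ => h₂ s)
            (hF₂c.intervalIntegrable _ _)
      _ ≤ F₁ t := by linarith [(hconv a (ha.trans_lt ht)).1]
  have hIic : IntegrableOn ē (Iic t) := by
    refine integrableOn_Iic_of_intervalIntegral_norm_bounded (F₁ t) t
      (fun a => hēc.integrableOn_Ioc) Filter.tendsto_id ?_
    filter_upwards [Filter.eventually_le_atBot t] with a ha
    simpa only [Real.norm_eq_abs, abs_of_nonneg (hē0 _), id] using hint a ha
  have hstrip : IntegrableOn e (strip c L t) := by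
    rw [IntegrableOn, volume_restrict_strip,
      integrable_prod_iff he.aestronglyMeasurable]
    refine ⟨Filter.Eventually.of_forall fun s => (he.comp (hslc s)).integrableOn_Ioc, ?_⟩
    refine (hIic.mono_set Iio_subset_Iic_self).congr (Filter.Eventually.of_forall fun s => ?_)
    simp only [hē, Real.norm_eq_abs, abs_of_nonneg (he0 _), intervalIntegral.integral_of_le hcL]
  refine ⟨hstrip, hIic, ?_, (hconv t ht).2⟩
  rw [setIntegral_strip hL.le hstrip]
  refine le_of_tendsto (intervalIntegral_tendsto_integral_Iic t hIic Filter.tendsto_id) ?_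
  filter_upwards [Filter.eventually_le_atBot t] with a ha using hint a ha

/-- Smooth functions that approximate the nonnegative function `f` within `δ`, are `l`-periodic in
the second variable, subharmonic for `t < S`, and vanish where `f` does. -/
structure IsApprox (f : ℝ × ℝ → ℝ) (l S δ : ℝ) (g : ℝ × ℝ → ℝ) : Prop where
  smooth : ContDiff ℝ ∞ g
  periodic : SndPeriodic l g
  nonneg : ∀ z, 0 ≤ g z
  close : ∀ z, |g z - f z| ≤ δ
  subharmonic : ∀ z : ℝ × ℝ, z.1 < S → 0 ≤ lap g z
  eq_zero : ∀ z, f z = 0 → g z = 0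

/-- The energy of `g` over the half strip `t < s`, `0 < θ ≤ l`. -/
noncomputable def energy (l : ℝ) (g : ℝ × ℝ → ℝ) (s : ℝ) : ℝ := ∫ z in strip 0 l s, gsq g z

/-- This is `energy_le_flux` for `P = g²/2`, where `ΔP = |∇g|² + g Δg ≥ |∇g|²`. -/
theorem IsApprox.energy_facts {f g : ℝ × ℝ → ℝ} {l S δ M : ℝ} (h : IsApprox f l S δ g) (hl : 0 < l)
    (hM : ∀ z, |f z| ≤ M) {t : ℝ} (ht : t < S) (c : ℝ) :
    IntegrableOn (gsq g) (strip c l t) ∧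
    IntegrableOn (fun s => ∫ θ in c..(c + l), gsq g (s, θ)) (Iic t) ∧
    ∫ z in strip c l t, gsq g z ≤ ∫ θ in c..(c + l), g (t, θ) * dr g (t, θ) := by
  have hgg : ContDiff ℝ ∞ fun z => g z * g z := h.smooth.mul h.smooth
  obtain ⟨h1, h2, h3, -⟩ := energy_le_flux (P := fun z => 1 / 2 * (g z * g z)) (e := gsq g)
    (B := 1 / 2 * ((M + δ) * (M + δ))) (c := c) hl (contDiff_const.mul hgg)
    (fun t θ => by simp only [h.periodic t θ])
    (fun z _ => by
      have h1 : |g z| ≤ M + δ := by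
        have := abs_add_le (g z - f z) (f z)
        rw [sub_add_cancel] at this
        linarith [h.close z, hM z]
      have h2 : 0 ≤ M + δ := (abs_nonneg _).trans h1
      rw [abs_mul, abs_mul, abs_of_pos (by norm_num : (0 : ℝ) < 1 / 2)]
      gcongr)
    (continuous_gsq h.smooth) (gsq_nonneg g)
    (fun z hz => by
      rw [lap_const_mul _ hgg, lap_mul_self h.smooth]
      have := mul_nonneg (h.nonneg z) (h.subharmonic z hz)
      linarith) ht
  refine ⟨h1, h2, h3.trans_eq (intervalIntegral.integral_congr fun θ _ => ?_)⟩
  simp only [dr_mul contDiff_const hgg, dr_const, dr_mul h.smooth h.smooth]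
  ring

/-- The difference `p` is not subharmonic, but `|p| ≤ η` gives `p Δp ≥ -η (Δg + Δg')`, so `P = p²/2
+ η (g + g')` satisfies `ΔP ≥ |∇p|²` and is of size `O(η)`. The period `L` is separate from `l` so
that strips of several periods are covered. -/
theorem IsApprox.energy_sub_le {f g g' : ℝ × ℝ → ℝ} {l L S δ δ' M : ℝ} (h : IsApprox f l S δ g)
    (h' : IsApprox f l S δ' g') (hM : ∀ z, |f z| ≤ M)
    (hL : 0 < L) (hp : SndPeriodic L g) (hp' : SndPeriodic L g') {η : ℝ} (hδ : δ + δ' ≤ η)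
    (hη : η ≤ 1) {t : ℝ} (ht : t < S) (c : ℝ) :
    IntegrableOn (gsq fun z => g z - g' z) (strip c L t) ∧
    ∫ z in strip c L t, gsq (fun z => g z - g' z) z ≤ 4 * (η * (2 * M + 3) * L) / (S - t) := by
  have hδ0 : 0 ≤ δ := (abs_nonneg _).trans (h.close 0)
  have hδ'0 : 0 ≤ δ' := (abs_nonneg _).trans (h'.close 0)
  set p : ℝ × ℝ → ℝ := fun z => g z - g' z with hpdef
  have hd : ContDiff ℝ ∞ p := h.smooth.sub h'.smooth
  have hclose : ∀ z, |p z| ≤ η := fun z => by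
    have h1 := abs_le.1 (h.close z)
    have h2 := abs_le.1 (h'.close z)
    rw [abs_le]
    constructor <;> simp only [hpdef] <;> linarith
  have hs : ContDiff ℝ ∞ fun z => g z + g' z := h.smooth.add h'.smooth
  have hlapp : ∀ z, lap p z = lap g z - lap g' z := fun z => by
    have e : p = fun z => g z + (-1) * g' z := by ext z; simp only [hpdef]; ring
    rw [e, lap_add h.smooth (contDiff_const.mul h'.smooth), lap_const_mul _ h'.smooth]
    ring
  obtain ⟨h1, -, h3, h4⟩ := energy_le_flux
    (P := fun z => 1 / 2 * (p z * p z) + η * (g z + g' z)) (e := gsq p)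
    (B := η * (2 * M + 3)) (c := c) hL
    ((contDiff_const.mul (hd.mul hd)).add (contDiff_const.mul hs))
    (fun t θ => by simp only [hpdef, hp t θ, hp' t θ])
    (fun z _ => by
      have h1 := abs_le.1 (h.close z)
      have h2 := abs_le.1 (h'.close z)
      have h3 := abs_le.1 (hM z)
      have h5 := h.nonneg z
      have h6 := h'.nonneg z
      have h7 : p z * p z ≤ η * 1 := by
        rw [← abs_mul_abs_self]
        have := abs_nonneg (p z)
        nlinarith [hclose z]
      have h8 : 0 ≤ p z * p z := mul_self_nonneg _
      have h9 : η * (g z + g' z) ≤ η * (2 * M + 1) := by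
        apply mul_le_mul_of_nonneg_left <;> linarith
      have h10 : 0 ≤ η * (g z + g' z) := by
        apply mul_nonneg <;> linarith
      rw [abs_le]
      constructor <;> nlinarith)
    (continuous_gsq hd) (gsq_nonneg p)
    (fun z hz => by
      rw [lap_add (contDiff_const.mul (hd.mul hd)) (contDiff_const.mul hs),
        lap_const_mul _ (hd.mul hd), lap_mul_self hd, lap_const_mul _ hs,
        lap_add h.smooth h'.smooth, hlapp]
      have h1 := abs_le.1 (hclose z)
      nlinarith [h.subharmonic z hz, h'.subharmonic z hz]) ht
  exact ⟨h1, h3.trans h4⟩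

/-! ### Wirtinger's inequality in terms of the measure of the support -/

/-- Serves to differentiate `p² w` at a zero of `p`, where the weight `w` used below need not be
differentiable. -/
theorem hasDerivAt_mul_of_continuousAt {u w : ℝ → ℝ} {x : ℝ} (hu : HasDerivAt u 0 x) (hx : u x = 0)
    (hw : ContinuousAt w x) : HasDerivAt (fun y => u y * w y) 0 x := by
  rw [hasDerivAt_iff_isLittleO] at hu ⊢
  simp only [hx, sub_zero, smul_zero, zero_mul] at hu ⊢
  simpa using hu.mul_isBigO (hw.tendsto.isBigO_one ℝ)

/-- A Riccati comparison in which the variable is `s(x)`, the length of the part of `[c, x]` where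
`p ≠ 0`. With `A = k s + d` and `C = cot A`, the derivative `D` of `k p² C` satisfies `p'² - k² p² -
D = (p' - k p C)² ≥ 0`, and `D` has integral zero since `p` vanishes at both ends. -/
theorem integral_sq_le_of_support {p p' : ℝ → ℝ} {c l k : ℝ} (hl : 0 ≤ l)
    (hp : ∀ x, HasDerivAt p (p' x) x) (hp' : Continuous p') (h0 : p c = 0) (h1 : p (c + l) = 0)
    (hk : 0 < k)
    (hka : k * (∫ x in c..(c + l), {x | p x ≠ 0}.indicator (fun _ => (1 : ℝ)) x) < Real.pi) :
    k ^ 2 * ∫ x in c..(c + l), p x ^ 2 ≤ ∫ x in c..(c + l), p' x ^ 2 := by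
  have hpc : Continuous p := continuous_iff_continuousAt.2 fun x => (hp x).continuousAt
  have hopen : IsOpen {x | p x ≠ 0} := hpc.isOpen_preimage _ isOpen_compl_singleton
  set χ : ℝ → ℝ := {x | p x ≠ 0}.indicator fun _ => (1 : ℝ) with hχ
  have hχm : StronglyMeasurable χ := stronglyMeasurable_const.indicator hopen.measurableSet
  have hχ0 : ∀ x, 0 ≤ χ x := fun x => indicator_nonneg (fun _ _ => zero_le_one) x
  have hχint : ∀ a b, IntervalIntegrable χ volume a b := fun a b =>
    (intervalIntegrable_const (c := (1 : ℝ))).mono_fun hχm.aestronglyMeasurable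
      (Filter.Eventually.of_forall fun x => by
        by_cases h : p x ≠ 0 <;> simp [hχ, h])
  set s : ℝ → ℝ := fun x => ∫ y in c..x, χ y with hs
  have hsc : Continuous s := intervalIntegral.continuous_primitive hχint c
  have hsd : ∀ x, p x ≠ 0 → HasDerivAt s 1 x := by
    intro x hx
    have hev : χ =ᶠ[nhds x] fun _ => 1 := by
      filter_upwards [hopen.mem_nhds hx] with y hy
      exact indicator_of_mem hy _
    have := intervalIntegral.integral_hasDerivAt_right (hχint c x)
      hχm.stronglyMeasurableAtFilter (continuousAt_const.congr hev.symm)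
    rwa [hev.eq_of_nhds] at this
  set a := s (c + l) with ha
  -- Half of the slack `π - k a`, so that `A` stays in `[d, π - d]` and `sin A` has no zero.
  set d := (Real.pi - k * a) / 2 with hd
  have hd0 : 0 < d := by rw [hd]; linarith
  set A : ℝ → ℝ := fun x => k * s x + d with hA
  have hAc : Continuous A := by fun_prop
  have hsin : ∀ x ∈ Icc c (c + l), 0 < Real.sin (A x) := by
    intro x hx
    have hs0 : 0 ≤ s x := intervalIntegral.integral_nonneg hx.1 fun y _ => hχ0 y
    have hsa : s x ≤ a := by
      have h := intervalIntegral.integral_add_adjacent_intervals (hχint c x) (hχint x (c + l))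
      have h' : 0 ≤ ∫ y in x..(c + l), χ y :=
        intervalIntegral.integral_nonneg hx.2 fun y _ => hχ0 y
      simp only [ha, hs]
      linarith
    have h2 := mul_le_mul_of_nonneg_left hsa hk.le
    have h3 := mul_nonneg hk.le hs0
    apply Real.sin_pos_of_pos_of_lt_pi
    · simp only [hA]; linarith
    · simp only [hA]; linarith
  set C : ℝ → ℝ := fun x => Real.cos (A x) / Real.sin (A x) with hC
  set D : ℝ → ℝ := fun x => 2 * p x * p' x * k * C x - p x ^ 2 * k ^ 2 * (1 + C x ^ 2) with hD
  have hCc : ContinuousOn C (Icc c (c + l)) :=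
    (Real.continuous_cos.comp hAc).continuousOn.div (Real.continuous_sin.comp hAc).continuousOn
      fun x hx => (hsin x hx).ne'
  have hDc : ContinuousOn D (Icc c (c + l)) := by fun_prop
  have hYd : ∀ x ∈ Ioo c (c + l), HasDerivAt (fun x => p x ^ 2 * (k * C x)) (D x) x := by
    intro x hx
    have hsx := hsin x (Ioo_subset_Icc_self hx)
    -- Where `p x ≠ 0` the length `s` has derivative `1`; where `p x = 0` it may fail to be
    -- differentiable, but `p²` vanishes to first order.
    by_cases hpx : p x = 0
    · have e : D x = 0 := by simp [hD, hpx]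
      rw [e]
      apply hasDerivAt_mul_of_continuousAt
      · exact ((hp x).fun_pow 2).congr_deriv (by simp [hpx])
      · simp [hpx]
      · exact continuousAt_const.mul (hCc.continuousAt (Icc_mem_nhds hx.1 hx.2))
    · have hAd : HasDerivAt A k x := by
        exact (((hsd x hpx).const_mul k).add_const d).congr_deriv (mul_one k)
      have hCd := (hAd.cos).div hAd.sin hsx.ne'
      have e : (-Real.sin (A x) * k * Real.sin (A x) - Real.cos (A x) * (Real.cos (A x) * k)) /
          Real.sin (A x) ^ 2 = -k * (1 + C x ^ 2) := by
        simp only [hC]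
        field_simp
        ring
      rw [e] at hCd
      refine (((hp x).fun_pow 2).mul (hCd.const_mul k)).congr_deriv ?_
      simp only [hD, hC, Pi.div_apply]
      push_cast
      ring
  have hDi : IntervalIntegrable D volume c (c + l) :=
    ContinuousOn.intervalIntegrable_of_Icc (by linarith) hDc
  have hDint : ∫ x in c..(c + l), D x = 0 := by
    rw [intervalIntegral.integral_eq_sub_of_hasDerivAt_of_le (by linarith)
      ((hpc.pow 2).continuousOn.mul (continuousOn_const.mul hCc)) hYd hDi]
    simp [h0, h1]
  have hp2 : IntervalIntegrable (fun x => k ^ 2 * p x ^ 2) volume c (c + l) :=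
    (continuous_const.mul (hpc.pow 2)).intervalIntegrable _ _
  rw [← intervalIntegral.integral_const_mul, ← add_zero (∫ x in c..(c + l), k ^ 2 * p x ^ 2),
    ← hDint, ← intervalIntegral.integral_add hp2 hDi]
  refine intervalIntegral.integral_mono_on (by linarith) (hp2.add hDi)
    ((hp'.pow 2).intervalIntegrable _ _) fun x _ => ?_
  have := sq_nonneg (p' x - k * p x * C x)
  simp only [hD]
  nlinarith

/-- A slice inequality: the flux `∫ p q` is controlled by the energy of the slice. -/
theorem flux_le_of_support {p p' q : ℝ → ℝ} {l k : ℝ} (hl : 0 ≤ l)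
    (hp : ∀ x, HasDerivAt p (p' x) x) (hp' : Continuous p') (hq : Continuous q)
    (hper : Function.Periodic p l) (hper' : Function.Periodic p' l) {c : ℝ} (h0 : p c = 0)
    (hk : 0 < k)
    (hka : k * (∫ x in (0)..l, {x | p x ≠ 0}.indicator (fun _ => (1 : ℝ)) x) < Real.pi) :
    2 * k * ∫ x in (0)..l, p x * q x ≤ ∫ x in (0)..l, (q x ^ 2 + p' x ^ 2) := by
  have hpc : Continuous p := continuous_iff_continuousAt.2 fun x => (hp x).continuousAt
  have shift : ∀ f : ℝ → ℝ, Function.Periodic f l → ∫ x in c..(c + l), f x = ∫ x in (0)..l, f x :=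
    fun f hf => by simpa using hf.intervalIntegral_add_eq c 0
  have hind : Function.Periodic ({x | p x ≠ 0}.indicator fun _ => (1 : ℝ)) l := fun x => by
    simp only [indicator, mem_ofPred_eq, hper x]
  have h := integral_sq_le_of_support hl hp hp' h0 ((hper c).trans h0) hk
    (by rwa [shift _ hind])
  rw [shift _ (fun x => by simp only [hper x]), shift _ (fun x => by simp only [hper' x])] at h
  have hq2 : IntervalIntegrable (fun x => q x ^ 2) volume 0 l := (hq.pow 2).intervalIntegrable _ _
  have hp2 : IntervalIntegrable (fun x => k ^ 2 * p x ^ 2) volume 0 l :=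
    (continuous_const.mul (hpc.pow 2)).intervalIntegrable _ _
  have hp'2 : IntervalIntegrable (fun x => p' x ^ 2) volume 0 l :=
    (hp'.pow 2).intervalIntegrable _ _
  rw [intervalIntegral.integral_add hq2 hp'2]
  have h2 : ∫ x in (0)..l, 2 * k * (p x * q x) ≤ ∫ x in (0)..l, (k ^ 2 * p x ^ 2 + q x ^ 2) :=
    intervalIntegral.integral_mono_on hl
      ((continuous_const.mul (hpc.mul hq)).intervalIntegrable _ _)
      (hp2.add hq2) fun x _ => by nlinarith [sq_nonneg (k * p x - q x)]
  rw [intervalIntegral.integral_const_mul, intervalIntegral.integral_add hp2 hq2,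
    intervalIntegral.integral_const_mul] at h2
  linarith

theorem integral_indicator_support_add_le {p q : ℝ → ℝ} {l : ℝ} (hl : 0 ≤ l) (hp : Continuous p)
    (hq : Continuous q) (hpq : ∀ x, p x * q x = 0) :
    (∫ x in (0)..l, {x | p x ≠ 0}.indicator (fun _ => (1 : ℝ)) x) +
      (∫ x in (0)..l, {x | q x ≠ 0}.indicator (fun _ => (1 : ℝ)) x) ≤ l := by
  have hint : ∀ f : ℝ → ℝ, Continuous f →
      IntervalIntegrable ({x | f x ≠ 0}.indicator fun _ => (1 : ℝ)) volume 0 l := fun f hf =>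
    (intervalIntegrable_const (c := (1 : ℝ))).mono_fun
      (stronglyMeasurable_const.indicator
        (hf.isOpen_preimage _ isOpen_compl_singleton).measurableSet).aestronglyMeasurable
      (Filter.Eventually.of_forall fun x => by
        by_cases h : f x ≠ 0 <;> simp [indicator, h])
  rw [← intervalIntegral.integral_add (hint p hp) (hint q hq)]
  calc _ ≤ ∫ _ in (0)..l, (1 : ℝ) := intervalIntegral.integral_mono_on hl
        ((hint p hp).add (hint q hq)) intervalIntegrable_const fun x _ => ?_
    _ = l := by simp
  rcases mul_eq_zero.1 (hpq x) with h | h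
  · by_cases h' : q x = 0 <;> simp [indicator, h, h']
  · by_cases h' : p x = 0 <;> simp [indicator, h, h']

/-! ### Monotonicity for smooth functions on the half cylinder -/

/-- The differential inequality behind the monotonicity formula, on one slice. -/
theorem slice_product_inequality {p p' pt q q' qt : ℝ → ℝ} {l α Ep Eq : ℝ} (hl : 0 < l)
    (hα : α ≤ 4 * Real.pi / l)
    (hp : ∀ x, HasDerivAt p (p' x) x) (hp' : Continuous p') (hpt : Continuous pt)
    (hper : Function.Periodic p l) (hper' : Function.Periodic p' l)
    (hq : ∀ x, HasDerivAt q (q' x) x) (hq' : Continuous q') (hqt : Continuous qt)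
    (hqer : Function.Periodic q l) (hqer' : Function.Periodic q' l)
    (hpq : ∀ x, p x * q x = 0) (hEp0 : 0 ≤ Ep) (hEq0 : 0 ≤ Eq)
    (hEp : Ep ≤ ∫ x in (0)..l, p x * pt x) (hEq : Eq ≤ ∫ x in (0)..l, q x * qt x) :
    2 * α * (Ep * Eq) ≤ (∫ x in (0)..l, (pt x ^ 2 + p' x ^ 2)) * Eq +
      Ep * ∫ x in (0)..l, (qt x ^ 2 + q' x ^ 2) := by
  set ep := ∫ x in (0)..l, (pt x ^ 2 + p' x ^ 2) with hep
  set eq := ∫ x in (0)..l, (qt x ^ 2 + q' x ^ 2) with heq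
  have hep0 : 0 ≤ ep := intervalIntegral.integral_nonneg hl.le fun x _ => by positivity
  have heq0 : 0 ≤ eq := intervalIntegral.integral_nonneg hl.le fun x _ => by positivity
  have hRHS : 0 ≤ ep * Eq + Ep * eq := by positivity
  -- If one function vanishes on the whole slice, its flux and hence its energy is zero. Otherwise
  -- each function vanishes at a point where the other does not, which supplies the zero for
  -- Wirtinger's inequality.
  by_cases hpz : ∀ x, p x = 0
  · have : Ep = 0 := le_antisymm (by simpa [hpz] using hEp) hEp0
    simpa [this] using mul_nonneg hep0 hEq0
  by_cases hqz : ∀ x, q x = 0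
  · have : Eq = 0 := le_antisymm (by simpa [hqz] using hEq) hEq0
    simpa [this] using mul_nonneg hEp0 heq0
  push Not at hpz hqz
  obtain ⟨x₁, hx₁⟩ := hpz
  obtain ⟨x₂, hx₂⟩ := hqz
  have hq0 : q x₁ = 0 := (mul_eq_zero.1 (hpq x₁)).resolve_left hx₁
  have hp0 : p x₂ = 0 := (mul_eq_zero.1 (hpq x₂)).resolve_right hx₂
  set a := ∫ x in (0)..l, {x | p x ≠ 0}.indicator (fun _ => (1 : ℝ)) x with ha
  set b := ∫ x in (0)..l, {x | q x ≠ 0}.indicator (fun _ => (1 : ℝ)) x with hb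
  have ha0 : 0 ≤ a := intervalIntegral.integral_nonneg hl.le fun x _ =>
    indicator_nonneg (fun _ _ => zero_le_one) x
  have hb0 : 0 ≤ b := intervalIntegral.integral_nonneg hl.le fun x _ =>
    indicator_nonneg (fun _ _ => zero_le_one) x
  have hab : a + b ≤ l := integral_indicator_support_add_le hl.le
    (continuous_iff_continuousAt.2 fun x => (hp x).continuousAt)
    (continuous_iff_continuousAt.2 fun x => (hq x).continuousAt) hpq
  have hπ := Real.pi_pos
  -- Enlarging `a` and `b` by `ε` makes `k a < π` strict for `k = π/(a + ε)` and avoids a division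
  -- by zero.
  have key : ∀ ε > 0, 8 * Real.pi * (Ep * Eq) ≤ (ep * Eq + Ep * eq) * (l + 2 * ε) := by
    intro ε hε
    have hk : ∀ x : ℝ, 0 ≤ x → Real.pi / (x + ε) * x < Real.pi := fun x hx => by
      rw [div_mul_eq_mul_div, div_lt_iff₀ (by positivity)]
      nlinarith
    have h1 := flux_le_of_support hl.le hp hp' hpt hper hper' hp0
      (k := Real.pi / (a + ε)) (by positivity) (hk a ha0)
    have h2 := flux_le_of_support hl.le hq hq' hqt hqer hqer' hq0
      (k := Real.pi / (b + ε)) (by positivity) (hk b hb0)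
    have h3 : 2 * (Real.pi / (a + ε)) * Ep ≤ ep :=
      (mul_le_mul_of_nonneg_left hEp (by positivity)).trans h1
    have h4 : 2 * (Real.pi / (b + ε)) * Eq ≤ eq :=
      (mul_le_mul_of_nonneg_left hEq (by positivity)).trans h2
    -- The inequality of harmonic and arithmetic means, with `a + b ≤ l`.
    have h5 : 4 / (l + 2 * ε) ≤ 1 / (a + ε) + 1 / (b + ε) := by
      calc 4 / (l + 2 * ε) ≤ 4 / ((a + ε) + (b + ε)) := by
            apply div_le_div_of_nonneg_left <;> linarith
        _ ≤ 1 / (a + ε) + 1 / (b + ε) := by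
            have h1 : 0 < a + ε := by linarith
            have h2 : 0 < b + ε := by linarith
            rw [div_add_div _ _ h1.ne' h2.ne', div_le_div_iff₀ (by positivity) (by positivity)]
            nlinarith [sq_nonneg (a + ε - (b + ε))]
    have h6 : 2 * Real.pi * (4 / (l + 2 * ε)) * (Ep * Eq) ≤ ep * Eq + Ep * eq := by
      calc _ ≤ 2 * Real.pi * (1 / (a + ε) + 1 / (b + ε)) * (Ep * Eq) := by gcongr
        _ = 2 * (Real.pi / (a + ε)) * Ep * Eq + Ep * (2 * (Real.pi / (b + ε)) * Eq) := by ring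
        _ ≤ _ := by gcongr
    have h7 : 0 < l + 2 * ε := by positivity
    calc 8 * Real.pi * (Ep * Eq) =
          2 * Real.pi * (4 / (l + 2 * ε)) * (Ep * Eq) * (l + 2 * ε) := by field_simp; ring
      _ ≤ _ := by gcongr
  have hlim : 8 * Real.pi * (Ep * Eq) ≤ (ep * Eq + Ep * eq) * l := by
    refine le_of_forall_pos_le_add fun ε hε => ?_
    refine (key (ε / (2 * (ep * Eq + Ep * eq + 1))) (by positivity)).trans ?_
    rw [mul_add]
    gcongr
    have : (ep * Eq + Ep * eq) * (2 * (ε / (2 * (ep * Eq + Ep * eq + 1)))) =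
        ε * ((ep * Eq + Ep * eq) / (ep * Eq + Ep * eq + 1)) := by field_simp
    rw [this]
    exact mul_le_of_le_one_right hε.le ((div_le_one (by positivity)).2 (by linarith))
  have h8 : α * l ≤ 4 * Real.pi := (le_div_iff₀ hl).1 hα
  have h9 := mul_le_mul_of_nonneg_right h8 (mul_nonneg hEp0 hEq0)
  exact le_of_mul_le_mul_right (by linarith) hl

/-- Monotonicity for smooth approximants with disjoint supports. -/
theorem IsApprox.monotone_product {f g f' g' : ℝ × ℝ → ℝ} {l S δ δ' M M' α : ℝ}
    (h : IsApprox f l S δ g) (h' : IsApprox f' l S δ' g') (hl : 0 < l)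
    (hα : α ≤ 4 * Real.pi / l) (hM : ∀ z, |f z| ≤ M) (hM' : ∀ z, |f' z| ≤ M')
    (hdisj : ∀ z, f z * f' z = 0) :
    MonotoneOn (fun t => Real.exp (-(2 * α * t)) * (energy l g t * energy l g' t)) (Iio S) := by
  have hE0 : ∀ (g : ℝ × ℝ → ℝ) t, 0 ≤ energy l g t := fun g t =>
    setIntegral_nonneg (measurableSet_strip _ _ _) fun z _ => gsq_nonneg g z
  have hderiv : ∀ {f g : ℝ × ℝ → ℝ} {δ M : ℝ}, IsApprox f l S δ g → (∀ z, |f z| ≤ M) →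
      ∀ t < S, HasDerivAt (energy l g) (∫ θ in (0)..l, gsq g (t, θ)) t := by
    intro f g δ M h hM t ht
    obtain ⟨m, hm, hmS⟩ := exists_between ht
    have hc : Continuous fun s => ∫ θ in (0)..l, gsq g (s, θ) :=
      continuous_slice_integral (continuous_gsq h.smooth) _ _
    have hE : ∀ s < S, energy l g s = ∫ τ in Iic s, ∫ θ in (0)..l, gsq g (τ, θ) := fun s hs => by
      rw [energy, setIntegral_strip hl.le (h.energy_facts hl hM hs 0).1, zero_add]
    have hI : ∀ s < S, IntegrableOn (fun s => ∫ θ in (0)..l, gsq g (s, θ)) (Iic s) := fun s hs => by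
      simpa using (h.energy_facts hl hM hs 0).2.1
    have h1 := intervalIntegral.integral_hasDerivAt_right (hc.intervalIntegrable t t)
      hc.stronglyMeasurable.stronglyMeasurableAtFilter hc.continuousAt
    -- Near `t` the energy is its value at `t` plus a primitive of the continuous slice energy.
    refine (h1.const_add (energy l g t)).congr_of_eventuallyEq ?_
    filter_upwards [Iio_mem_nhds ht] with s hs
    rw [hE s hs, hE t ht, ← intervalIntegral.integral_Iic_sub_Iic (hI t ht) (hI s hs)]
    ring
  have hd : ∀ t < S, HasDerivAt
      (fun t => Real.exp (-(2 * α * t)) * (energy l g t * energy l g' t))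
      (Real.exp (-(2 * α * t)) * ((∫ θ in (0)..l, gsq g (t, θ)) * energy l g' t +
        energy l g t * (∫ θ in (0)..l, gsq g' (t, θ)) -
          2 * α * (energy l g t * energy l g' t))) t := fun t ht => by
    have he : HasDerivAt (fun t => Real.exp (-(2 * α * t)))
        (Real.exp (-(2 * α * t)) * (-(2 * α * 1))) t :=
      (((hasDerivAt_id t).const_mul (2 * α)).neg).exp
    refine (he.mul ((hderiv h hM t ht).mul (hderiv h' hM' t ht))).congr_deriv ?_
    simp only [Pi.mul_apply]
    ring
  refine monotoneOn_of_deriv_nonneg (convex_Iio S)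
    (fun t ht => (hd t ht).continuousAt.continuousWithinAt)
    (fun t ht => (hd t (interior_subset (s := Iio S) ht)).differentiableAt.differentiableWithinAt)
    fun t ht => ?_
  rw [interior_Iio] at ht
  rw [(hd t ht).deriv]
  have hslc : Continuous fun θ : ℝ => (t, θ) := by fun_prop
  have hp0 : ∀ x, g (t, x) * g' (t, x) = 0 := fun x => by
    rcases mul_eq_zero.1 (hdisj (t, x)) with h1 | h1
    · rw [h.eq_zero _ h1, zero_mul]
    · rw [h'.eq_zero _ h1, mul_zero]
  have := slice_product_inequality hl hα
    (fun x => ContDiff.dθ_slice h.smooth t x) ((contDiff_dθ h.smooth).continuous.comp hslc)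
    ((contDiff_dr h.smooth).continuous.comp hslc) (fun x => h.periodic t x)
    (fun x => h.periodic.dθ h.smooth t x)
    (fun x => ContDiff.dθ_slice h'.smooth t x) ((contDiff_dθ h'.smooth).continuous.comp hslc)
    ((contDiff_dr h'.smooth).continuous.comp hslc) (fun x => h'.periodic t x)
    (fun x => h'.periodic.dθ h'.smooth t x) hp0 (hE0 g t) (hE0 g' t)
    (by simpa [energy] using (h.energy_facts hl hM ht 0).2.2)
    (by simpa [energy] using (h'.energy_facts hl hM' ht 0).2.2)
  refine mul_nonneg (Real.exp_nonneg _) (sub_nonneg.2 ?_)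
  exact this

/-! ### Mollification of continuous subharmonic functions -/

/-- `β` is the primitive of a smooth step that rises from `0` to `1` on `[δ, 2δ]`. The signs of `β'`
and `β''` preserve subharmonicity under composition; the flat piece removes small positive values
created by mollification. -/
theorem exists_convex_cutoff {δ : ℝ} (hδ : 0 < δ) : ∃ β : ℝ → ℝ, ContDiff ℝ ∞ β ∧
    (∀ s, 0 ≤ deriv β s) ∧ (∀ s, 0 ≤ deriv (deriv β) s) ∧ (∀ s, s ≤ δ → 0 ≤ s → β s = 0) ∧
    (∀ s, 0 ≤ s → 0 ≤ β s ∧ |β s - s| ≤ 2 * δ) := by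
  set σ : ℝ → ℝ := fun x => Real.smoothTransition (x / δ - 1) with hσ
  have hσs : ContDiff ℝ ∞ σ := Real.smoothTransition.contDiff.comp
    ((contDiff_id.div_const δ).sub contDiff_const)
  have hσc := hσs.continuous
  have hσ0 : ∀ x, 0 ≤ σ x := fun x => Real.smoothTransition.nonneg _
  have hσ1 : ∀ x, σ x ≤ 1 := fun x => Real.smoothTransition.le_one _
  have hd : ∀ s, HasDerivAt (fun s => ∫ x in (0)..s, σ x) (σ s) s := fun s =>
    intervalIntegral.integral_hasDerivAt_right (hσc.intervalIntegrable _ _)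
      hσc.stronglyMeasurable.stronglyMeasurableAtFilter hσc.continuousAt
  have hd' : deriv (fun s => ∫ x in (0)..s, σ x) = σ := funext fun s => (hd s).deriv
  have hle : ∀ a b, a ≤ b → 0 ≤ ∫ x in a..b, σ x ∧ ∫ x in a..b, σ x ≤ b - a := fun a b hab =>
    ⟨intervalIntegral.integral_nonneg hab fun x _ => hσ0 x, by
      have := intervalIntegral.integral_mono_on hab (hσc.intervalIntegrable a b)
        (intervalIntegrable_const (c := (1 : ℝ)) (μ := volume)) fun x _ => hσ1 x
      simpa using this⟩
  refine ⟨fun s => ∫ x in (0)..s, σ x, ?_, ?_, ?_, ?_, ?_⟩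
  · rw [contDiff_infty_iff_deriv, hd']
    exact ⟨fun s => (hd s).differentiableAt, hσs⟩
  · rw [hd']; exact hσ0
  · rw [hd']
    have : Monotone σ := fun x y hxy => Real.smoothTransition.monotone (by gcongr)
    exact fun s => this.deriv_nonneg
  · intro s hs hs0
    refine (intervalIntegral.integral_congr (g := fun _ => 0) fun x hx => ?_).trans (by simp)
    rw [uIcc_of_le hs0] at hx
    exact Real.smoothTransition.zero_of_nonpos
      (by rw [sub_nonpos, div_le_one hδ]; exact hx.2.trans hs)
  · intro s hs
    have h1 := hle 0 s hs
    refine ⟨h1.1, ?_⟩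
    rw [abs_le]
    refine ⟨?_, by linarith⟩
    rcases le_total s (2 * δ) with h | h
    · linarith
    · have h2 : ∫ x in (2 * δ)..s, σ x = s - 2 * δ := by
        rw [intervalIntegral.integral_congr (g := fun _ => (1 : ℝ)) fun x hx => ?_]
        · simp
        rw [uIcc_of_le h] at hx
        apply Real.smoothTransition.one_of_one_le
        rw [le_sub_iff_add_le, le_div_iff₀ hδ]
        linarith [hx.1]
      have h3 := hle 0 (2 * δ) (by linarith)
      have h4 := intervalIntegral.integral_add_adjacent_intervals
        (hσc.intervalIntegrable 0 (2 * δ)) (hσc.intervalIntegrable (2 * δ) s) (μ := volume)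
      linarith

/-- The convolution of two functions on the plane. -/
noncomputable def conv (f η : ℝ × ℝ → ℝ) (z : ℝ × ℝ) : ℝ := ∫ w, f w * η (z - w)

open scoped Convolution in
theorem conv_eq (f η : ℝ × ℝ → ℝ) :
    conv f η = (f ⋆[ContinuousLinearMap.lsmul ℝ ℝ, volume] η : ℝ × ℝ → ℝ) := rfl

theorem contDiff_conv {f η : ℝ × ℝ → ℝ} (hf : Continuous f) (hη : ContDiff ℝ ∞ η)
    (hc : HasCompactSupport η) : ContDiff ℝ ∞ (conv f η) := by
  rw [conv_eq]
  exact hc.contDiff_convolution_right _ hf.locallyIntegrable hη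

theorem hasCompactSupport_dr {η : ℝ × ℝ → ℝ} (hc : HasCompactSupport η) :
    HasCompactSupport (dr η) := hc.fderiv_apply (𝕜 := ℝ) _

theorem hasCompactSupport_dθ {η : ℝ × ℝ → ℝ} (hc : HasCompactSupport η) :
    HasCompactSupport (dθ η) := hc.fderiv_apply (𝕜 := ℝ) _

theorem fderiv_conv_apply {f η : ℝ × ℝ → ℝ} (hf : Continuous f) (hη : ContDiff ℝ ∞ η)
    (hc : HasCompactSupport η) (z v : ℝ × ℝ) :
    fderiv ℝ (conv f η) z v = conv f (fun w => fderiv ℝ η w v) z := by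
  rw [conv_eq, conv_eq, (hc.hasFDerivAt_convolution_right _ hf.locallyIntegrable
    (hη.of_le (by simp)) z).fderiv]
  exact convolution_precompR_apply _ hf.locallyIntegrable (hc.fderiv ℝ)
    (hη.continuous_fderiv (by simp)) z v

/-- Both derivatives fall on the kernel, and the two signs from the reflection `w ↦ z - w` cancel.
Thus the Laplacian at `z` is `f` tested against a translated reflected kernel, which is where weak
subharmonicity enters. -/
theorem lap_conv {f η : ℝ × ℝ → ℝ} (hf : Continuous f) (hη : ContDiff ℝ ∞ η)
    (hc : HasCompactSupport η) (z : ℝ × ℝ) :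
    lap (conv f η) z = ∫ w, f w * lap (fun w => η (z - w)) w := by
  have h1 : dr (conv f η) = conv f (dr η) := funext fun z => fderiv_conv_apply hf hη hc z _
  have h2 : dθ (conv f η) = conv f (dθ η) := funext fun z => fderiv_conv_apply hf hη hc z _
  have h3 : dr (dr (conv f η)) z = conv f (dr (dr η)) z := by
    rw [h1]
    exact fderiv_conv_apply hf (contDiff_dr hη) (hasCompactSupport_dr hc) z _
  have h4 : dθ (dθ (conv f η)) z = conv f (dθ (dθ η)) z := by
    rw [h2]
    exact fderiv_conv_apply hf (contDiff_dθ hη) (hasCompactSupport_dθ hc) z _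
  have refl_r : ∀ ψ : ℝ × ℝ → ℝ, ContDiff ℝ ∞ ψ →
      dr (fun w => ψ (z - w)) = fun w => -dr ψ (z - w) := fun ψ hψ => funext fun ⟨t, θ⟩ =>
    dr_eq_of_hasDerivAt ((hψ.comp (contDiff_const.sub contDiff_id)).differentiable (by simp) _)
      ((ContDiff.dr_slice hψ (z.1 - t) (z.2 - θ)).comp_const_sub z.1 t)
  have refl_θ : ∀ ψ : ℝ × ℝ → ℝ, ContDiff ℝ ∞ ψ →
      dθ (fun w => ψ (z - w)) = fun w => -dθ ψ (z - w) := fun ψ hψ => funext fun ⟨t, θ⟩ =>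
    dθ_eq_of_hasDerivAt ((hψ.comp (contDiff_const.sub contDiff_id)).differentiable (by simp) _)
      ((ContDiff.dθ_slice hψ (z.1 - t) (z.2 - θ)).comp_const_sub z.2 θ)
  have hneg_r : ∀ ψ : ℝ × ℝ → ℝ, dr (fun w => -ψ w) = fun w => -dr ψ w := fun ψ =>
    funext fun w => by simp [dr]
  have hneg_θ : ∀ ψ : ℝ × ℝ → ℝ, dθ (fun w => -ψ w) = fun w => -dθ ψ w := fun ψ =>
    funext fun w => by simp [dθ]
  have h5 : ∀ w, lap (fun w => η (z - w)) w = dr (dr η) (z - w) + dθ (dθ η) (z - w) := fun w => by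
    unfold lap
    rw [refl_r η hη, refl_θ η hη, hneg_r, hneg_θ, refl_r _ (contDiff_dr hη),
      refl_θ _ (contDiff_dθ hη)]
    simp
  have hint : ∀ ψ : ℝ × ℝ → ℝ, Continuous ψ → HasCompactSupport ψ →
      Integrable fun w => f w * ψ (z - w) := fun ψ hψ hψc => by
    have hcs : HasCompactSupport fun w => ψ (z - w) :=
      hψc.comp_homeomorph (Homeomorph.subLeft z)
    exact (hf.mul (hψ.comp (continuous_const.sub continuous_id))).integrable_of_hasCompactSupport
      hcs.mul_left
  unfold lap at h5 ⊢
  rw [h3, h4, conv, conv, ← integral_add (hint _ (contDiff_dr (contDiff_dr hη)).continuous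
      (hasCompactSupport_dr (hasCompactSupport_dr hc)))
    (hint _ (contDiff_dθ (contDiff_dθ hη)).continuous
      (hasCompactSupport_dθ (hasCompactSupport_dθ hc)))]
  exact integral_congr_ae (Filter.Eventually.of_forall fun w => by
    simp only [h5 w]; ring)

/-- Uniformly continuous nonnegative bounded functions, `l`-periodic in the second variable, that
are subharmonic for `t < T` in the sense of distributions. -/
structure IsModel (f : ℝ × ℝ → ℝ) (l T M : ℝ) : Prop where
  uniformContinuous : UniformContinuous f
  periodic : SndPeriodic l f
  nonneg : ∀ z, 0 ≤ f z
  bound : ∀ z, |f z| ≤ M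
  weak_subharmonic : ∀ ψ : ℝ × ℝ → ℝ, ContDiff ℝ ∞ ψ → HasCompactSupport ψ →
    tsupport ψ ⊆ {z | z.1 < T} → (∀ z, 0 ≤ ψ z) → 0 ≤ ∫ z, f z * lap ψ z

open scoped Convolution in
theorem IsModel.exists_approx {f : ℝ × ℝ → ℝ} {l T M : ℝ} (h : IsModel f l T M) {S δ : ℝ}
    (hS : S < T) (hδ : 0 < δ) : ∃ g, IsApprox f l S δ g := by
  -- Mollification costs `d` and `β` costs `2d`. Where `f` vanishes the mollified function is at
  -- most `d`, which `β` sends to `0`.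
  set d := δ / 3 with hd
  have hd0 : 0 < d := by positivity
  obtain ⟨β, hβ, hβ1, hβ2, hβ3, hβ4⟩ := exists_convex_cutoff hd0
  obtain ⟨ε₀, hε₀, hunif⟩ := Metric.uniformContinuous_iff.1 h.uniformContinuous d hd0
  -- The bound `T - S` keeps the kernels centred at height below `S` supported below height `T`.
  set ε := min ε₀ (T - S) with hε
  have hε0 : 0 < ε := lt_min hε₀ (sub_pos.2 hS)
  let φ : ContDiffBump (0 : ℝ × ℝ) := ⟨ε / 2 / 2, ε / 2, by positivity, by linarith⟩
  have hfc := h.uniformContinuous.continuous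
  set η : ℝ × ℝ → ℝ := φ.normed volume with hη
  have hηs : ContDiff ℝ ∞ η := φ.contDiff_normed
  have hηc : HasCompactSupport η := φ.hasCompactSupport_normed
  have hη0 : ∀ w, 0 ≤ η w := φ.nonneg_normed
  have hm : ContDiff ℝ ∞ (conv f η) := contDiff_conv hfc hηs hηc
  have hm0 : ∀ z, 0 ≤ conv f η z := fun z =>
    integral_nonneg fun w => mul_nonneg (h.nonneg w) (hη0 _)
  have hmclose : ∀ z, |conv f η z - f z| ≤ d := fun z => by
    have e : conv f η z = (η ⋆[ContinuousLinearMap.lsmul ℝ ℝ, volume] f : ℝ × ℝ → ℝ) z := by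
      rw [convolution_lsmul_swap, conv]
      exact integral_congr_ae (Filter.Eventually.of_forall fun w => by
        simp only [smul_eq_mul, mul_comm])
    rw [e]
    refine φ.dist_normed_convolution_le hfc.aestronglyMeasurable fun x hx => (hunif ?_).le
    have h1 : dist x z < ε / 2 := hx
    have h2 : ε ≤ ε₀ := min_le_left _ _
    linarith
  have hmper : SndPeriodic l (conv f η) := fun t θ => by
    unfold conv
    rw [← integral_add_right_eq_self _ ((0 : ℝ), l)]
    refine integral_congr_ae (Filter.Eventually.of_forall fun w => ?_)
    obtain ⟨w₁, w₂⟩ := w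
    simp [h.periodic w₁ w₂]
  have hmlap : ∀ z : ℝ × ℝ, z.1 < S → 0 ≤ lap (conv f η) z := fun z hz => by
    rw [lap_conv hfc hηs hηc]
    have hcs : HasCompactSupport fun w => η (z - w) :=
      hηc.comp_homeomorph (Homeomorph.subLeft z)
    refine h.weak_subharmonic _ (hηs.comp (contDiff_const.sub contDiff_id)) hcs ?_ fun w => hη0 _
    have hsub : tsupport (fun w => η (z - w)) ⊆ {w | z - w ∈ Metric.closedBall 0 (ε / 2)} := by
      refine closure_minimal (fun w hw => ?_)
        (Metric.isClosed_closedBall.preimage (continuous_const.sub continuous_id))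
      have : z - w ∈ Function.support η := hw
      rw [hη, φ.support_normed_eq] at this
      exact Metric.ball_subset_closedBall this
    intro w hw
    have h1 := hsub hw
    rw [mem_ofPred_eq, mem_closedBall_zero_iff] at h1
    have h2 := (norm_fst_le (z - w)).trans h1
    rw [Real.norm_eq_abs] at h2
    have h3 := (abs_le.1 h2).1
    have h4 : ε ≤ T - S := min_le_right _ _
    simp only [Prod.fst_sub] at h3
    show w.1 < T
    linarith
  refine ⟨fun z => β (conv f η z), hβ.comp hm, fun t θ => by simp only [hmper t θ],
    fun z => (hβ4 _ (hm0 z)).1, fun z => ?_, fun z hz => ?_, fun z hz => ?_⟩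
  · have h1 := abs_le.1 (hβ4 _ (hm0 z)).2
    have h2 := abs_le.1 (hmclose z)
    rw [abs_le]
    constructor <;> linarith
  · rw [lap_comp hβ hm]
    exact add_nonneg (mul_nonneg (hβ2 _) (gsq_nonneg _ _)) (mul_nonneg (hβ1 _) (hmlap z hz))
  · refine hβ3 _ ?_ (hm0 z)
    have := abs_le.1 (hmclose z)
    linarith

/-! ### Logarithmic polar coordinates -/

/-- The map `(t, θ) ↦ (eᵗ, θ)`. -/
noncomputable def expFst (w : ℝ × ℝ) : ℝ × ℝ := (Real.exp w.1, w.2)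

/-- The map `(r, θ) ↦ (log r, θ)`. -/
noncomputable def logFst (z : ℝ × ℝ) : ℝ × ℝ := (Real.log z.1, z.2)

theorem logFst_expFst (w : ℝ × ℝ) : logFst (expFst w) = w := by simp [logFst, expFst]

theorem expFst_logFst {z : ℝ × ℝ} (hz : 0 < z.1) : expFst (logFst z) = z := by
  simp [logFst, expFst, Real.exp_log hz]

theorem contDiff_expFst : ContDiff ℝ ∞ expFst :=
  (Real.contDiff_exp.comp contDiff_fst).prodMk contDiff_snd

theorem injective_expFst : Function.Injective expFst :=
  Function.LeftInverse.injective logFst_expFst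

theorem continuousOn_logFst : ContinuousOn logFst {z | 0 < z.1} :=
  (continuousOn_fst.log fun _ hz => (ne_of_gt hz)).prodMk continuousOn_snd

theorem hasFDerivAt_expFst (w : ℝ × ℝ) : HasFDerivAt expFst
    ((ContinuousLinearMap.toSpanSingleton ℝ (Real.exp w.1)).prodMap
      (ContinuousLinearMap.id ℝ ℝ)) w := by
  have h1 : HasFDerivAt (fun w : ℝ × ℝ => Real.exp w.1)
      ((ContinuousLinearMap.toSpanSingleton ℝ (Real.exp w.1)).comp
        (ContinuousLinearMap.fst ℝ ℝ ℝ)) w :=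
    (Real.hasDerivAt_exp w.1).hasFDerivAt.comp w hasFDerivAt_fst
  exact h1.prodMk hasFDerivAt_snd

theorem det_expFst (a : ℝ) : ((ContinuousLinearMap.toSpanSingleton ℝ a).prodMap
      (ContinuousLinearMap.id ℝ ℝ)).det = a := by
  rw [ContinuousLinearMap.det, ContinuousLinearMap.coe_prodMap, LinearMap.det_prodMap]
  simp

theorem setIntegral_image_expFst {A : Set (ℝ × ℝ)} (hA : MeasurableSet A) (F : ℝ × ℝ → ℝ) :
    ∫ z in expFst '' A, F z = ∫ w in A, Real.exp w.1 * F (expFst w) := by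
  rw [integral_image_eq_integral_abs_det_fderiv_smul volume hA
    (fun w _ => (hasFDerivAt_expFst w).hasFDerivWithinAt) injective_expFst.injOn]
  simp only [det_expFst, abs_of_pos (Real.exp_pos _), smul_eq_mul]

theorem integrableOn_image_expFst {A : Set (ℝ × ℝ)} (hA : MeasurableSet A) (F : ℝ × ℝ → ℝ) :
    IntegrableOn F (expFst '' A) ↔ IntegrableOn (fun w => Real.exp w.1 * F (expFst w)) A := by
  rw [integrableOn_image_iff_integrableOn_abs_det_fderiv_smul volume hA
    (fun w _ => (hasFDerivAt_expFst w).hasFDerivWithinAt) injective_expFst.injOn]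
  simp only [det_expFst, abs_of_pos (Real.exp_pos _), smul_eq_mul]

theorem image_expFst_univ : expFst '' univ = {z | 0 < z.1} := by
  ext z
  constructor
  · rintro ⟨w, -, rfl⟩
    exact Real.exp_pos _
  · exact fun hz => ⟨logFst z, trivial, expFst_logFst hz⟩

theorem image_expFst_strip {l R : ℝ} (hR : 0 < R) :
    expFst '' strip 0 l (Real.log R) = sector l R := by
  ext z
  constructor
  · rintro ⟨w, ⟨h1, h2⟩, rfl⟩
    refine ⟨⟨Real.exp_pos _, (Real.lt_log_iff_exp_lt hR).1 h1⟩, ?_⟩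
    simpa [expFst] using h2
  · rintro ⟨⟨h0, h1⟩, h2⟩
    refine ⟨logFst z, ⟨Real.log_lt_log h0 h1, ?_⟩, expFst_logFst h0⟩
    simpa [logFst] using h2

theorem integral_eq_integral_expFst {F : ℝ × ℝ → ℝ} (hF : ∀ z : ℝ × ℝ, z.1 ≤ 0 → F z = 0) :
    ∫ z, F z = ∫ w, Real.exp w.1 * F (expFst w) := by
  rw [← setIntegral_eq_integral_of_forall_compl_eq_zero (s := {z : ℝ × ℝ | 0 < z.1})
    (fun z hz => hF z (not_lt.1 hz)), ← image_expFst_univ,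
    setIntegral_image_expFst MeasurableSet.univ, setIntegral_univ]

theorem dr_eq_zero_of_notMem {φ : ℝ × ℝ → ℝ} {z : ℝ × ℝ} (hz : z ∉ tsupport φ) : dr φ z = 0 := by
  have : fderiv ℝ φ z = 0 := by
    by_contra h
    exact hz (support_fderiv_subset ℝ h)
  simp [dr, this]

theorem dθ_eq_zero_of_notMem {φ : ℝ × ℝ → ℝ} {z : ℝ × ℝ} (hz : z ∉ tsupport φ) : dθ φ z = 0 := by
  have : fderiv ℝ φ z = 0 := by
    by_contra h
    exact hz (support_fderiv_subset ℝ h)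
  simp [dθ, this]

theorem tsupport_dr_subset (φ : ℝ × ℝ → ℝ) : tsupport (dr φ) ⊆ tsupport φ :=
  closure_minimal (fun z hz => by
    by_contra h
    exact hz (dr_eq_zero_of_notMem h)) (isClosed_tsupport φ)

theorem tsupport_dθ_subset (φ : ℝ × ℝ → ℝ) : tsupport (dθ φ) ⊆ tsupport φ :=
  closure_minimal (fun z hz => by
    by_contra h
    exact hz (dθ_eq_zero_of_notMem h)) (isClosed_tsupport φ)

theorem lap_eq_zero_of_notMem {φ : ℝ × ℝ → ℝ} {z : ℝ × ℝ} (hz : z ∉ tsupport φ) :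
    lap φ z = 0 := by
  rw [lap, dr_eq_zero_of_notMem fun h => hz (tsupport_dr_subset φ h),
    dθ_eq_zero_of_notMem fun h => hz (tsupport_dθ_subset φ h), add_zero]

theorem polarLaplacian_eq_zero_of_notMem {φ : ℝ × ℝ → ℝ} {z : ℝ × ℝ} (hz : z ∉ tsupport φ) :
    polarLaplacian φ z = 0 := by
  rw [polarLaplacian, dr_eq_zero_of_notMem hz,
    dr_eq_zero_of_notMem fun h => hz (tsupport_dr_subset φ h),
    dθ_eq_zero_of_notMem fun h => hz (tsupport_dθ_subset φ h)]
  simp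

open Classical in
/-- A test function in the variables `(t, θ)`, read in the variables `(r, θ)`. -/
noncomputable def pushTest (ψ : ℝ × ℝ → ℝ) (z : ℝ × ℝ) : ℝ := if 0 < z.1 then ψ (logFst z) else 0

theorem pushTest_expFst (ψ : ℝ × ℝ → ℝ) (w : ℝ × ℝ) : pushTest ψ (expFst w) = ψ w := by
  rw [pushTest, if_pos (show 0 < (expFst w).1 from Real.exp_pos _), logFst_expFst]

theorem tsupport_pushTest_subset {ψ : ℝ × ℝ → ℝ} (hc : HasCompactSupport ψ) :
    tsupport (pushTest ψ) ⊆ expFst '' tsupport ψ := by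
  refine closure_minimal (fun z hz => ?_)
    (IsCompact.image hc contDiff_expFst.continuous).isClosed
  by_cases h0 : 0 < z.1
  · refine ⟨logFst z, subset_closure ?_, expFst_logFst h0⟩
    simpa [pushTest, h0] using hz
  · exact absurd (by simp [pushTest, h0]) hz

/-- The support is the image of a compact set, hence stays away from `r = 0`, and the extension by
zero is smooth. -/
theorem isTest_pushTest {ψ : ℝ × ℝ → ℝ} (hψ : ContDiff ℝ ∞ ψ) (hc : HasCompactSupport ψ)
    (hsub : tsupport ψ ⊆ {z | z.1 < 0}) : IsTest (pushTest ψ) := by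
  have hK : IsCompact (expFst '' tsupport ψ) := IsCompact.image hc contDiff_expFst.continuous
  refine ⟨?_, hK.of_isClosed_subset (isClosed_tsupport _) (tsupport_pushTest_subset hc), ?_⟩
  · rw [contDiff_iff_contDiffAt]
    intro z
    by_cases h0 : 0 < z.1
    · have h1 : ContDiffAt ℝ ∞ (fun z => ψ (logFst z)) z :=
        hψ.contDiffAt.comp z ((contDiffAt_fst.log h0.ne').prodMk contDiffAt_snd)
      refine h1.congr_of_eventuallyEq ?_
      filter_upwards [(isOpen_lt continuous_const continuous_fst).mem_nhds h0] with y hy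
      exact if_pos hy
    · have hz : z ∉ tsupport (pushTest ψ) := fun h => by
        obtain ⟨w, -, rfl⟩ := tsupport_pushTest_subset hc h
        exact h0 (Real.exp_pos _)
      exact (contDiffAt_const (c := (0 : ℝ))).congr_of_eventuallyEq
        (notMem_tsupport_iff_eventuallyEq.1 hz)
  · intro z hz
    obtain ⟨w, hw, rfl⟩ := tsupport_pushTest_subset hc hz
    exact ⟨⟨Real.exp_pos _, Real.exp_lt_one_iff.2 (hsub hw)⟩, trivial⟩

theorem dr_comp_expFst {φ : ℝ × ℝ → ℝ} (hφ : ContDiff ℝ ∞ φ) :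
    dr (fun w => φ (expFst w)) = fun w => Real.exp w.1 * dr φ (expFst w) := by
  ext ⟨t, θ⟩
  refine dr_eq_of_hasDerivAt ((hφ.comp contDiff_expFst).differentiable (by simp) _) ?_
  rw [mul_comm]
  exact (ContDiff.dr_slice hφ (Real.exp t) θ).comp t (Real.hasDerivAt_exp t)

theorem dθ_comp_expFst {φ : ℝ × ℝ → ℝ} (hφ : ContDiff ℝ ∞ φ) :
    dθ (fun w => φ (expFst w)) = fun w => dθ φ (expFst w) := by
  ext ⟨t, θ⟩
  exact dθ_eq_of_hasDerivAt ((hφ.comp contDiff_expFst).differentiable (by simp) _)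
    (ContDiff.dθ_slice hφ (Real.exp t) θ)

/-- Conformality: the factor `e^{2t}` is exactly the one in the area form `r dr dθ = e^{2t} dt dθ`,
so distributional subharmonicity has the same form in both coordinates. -/
theorem lap_comp_expFst {φ : ℝ × ℝ → ℝ} (hφ : ContDiff ℝ ∞ φ) (w : ℝ × ℝ) :
    lap (fun w => φ (expFst w)) w = Real.exp w.1 ^ 2 * polarLaplacian φ (expFst w) := by
  have he : ContDiff ℝ ∞ fun w : ℝ × ℝ => Real.exp w.1 := Real.contDiff_exp.comp contDiff_fst
  have hde : dr (fun w : ℝ × ℝ => Real.exp w.1) w = Real.exp w.1 :=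
    dr_eq_of_hasDerivAt (t := w.1) (θ := w.2) (he.differentiable (by simp) _)
      (Real.hasDerivAt_exp w.1)
  have h1 : dr (dr fun w => φ (expFst w)) w =
      Real.exp w.1 * dr φ (expFst w) + Real.exp w.1 * (Real.exp w.1 * dr (dr φ) (expFst w)) := by
    have hd : ContDiff ℝ ∞ fun w => dr φ (expFst w) := (contDiff_dr hφ).comp contDiff_expFst
    rw [dr_comp_expFst hφ, dr_mul he hd, dr_comp_expFst (contDiff_dr hφ)]
    simp only [hde]
  rw [lap, h1, dθ_comp_expFst hφ, dθ_comp_expFst (contDiff_dθ hφ), polarLaplacian]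
  have : Real.exp w.1 ≠ 0 := (Real.exp_pos _).ne'
  simp only [expFst]
  field_simp
  ring

/-! ### Functions on the cone as functions on the cylinder -/

variable {n : ℕ} {γ : ℝ → EuclideanSpace ℝ (Fin n)} {l : ℝ}

/-- A function on the cone in the variables `(t, θ)`, frozen for `t ≥ T`. -/
noncomputable def model (γ : ℝ → EuclideanSpace ℝ (Fin n)) (u : EuclideanSpace ℝ (Fin n) → ℝ)
    (T : ℝ) (w : ℝ × ℝ) : ℝ := u (Real.exp (min w.1 T) • γ w.2)

theorem smul_mem_coneBall (hγ : IsConeGenerator γ l) {r R : ℝ} (h0 : 0 ≤ r) (hr : r < R) (θ : ℝ) :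
    r • γ θ ∈ coneBall γ R :=
  ⟨⟨r, θ, h0, rfl⟩, by simpa [norm_smul, hγ.norm_eq_one, abs_of_nonneg h0] using hr⟩

theorem abs_exp_sub_exp_le {a b : ℝ} (ha : a ≤ 0) (hb : b ≤ 0) :
    |Real.exp a - Real.exp b| ≤ |a - b| := by
  wlog h : a ≤ b generalizing a b
  · rw [abs_sub_comm, abs_sub_comm a]
    exact this hb ha (le_of_not_ge h)
  have h1 : Real.exp a ≤ Real.exp b := Real.exp_le_exp.2 h
  rw [abs_of_nonpos (by linarith), abs_of_nonpos (by linarith)]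
  have h2 : Real.exp a = Real.exp b * Real.exp (a - b) := by rw [← Real.exp_add]; congr 1; ring
  have h3 := Real.add_one_le_exp (a - b)
  have h4 : Real.exp b ≤ 1 := Real.exp_le_one_iff.2 hb
  have h5 := Real.exp_pos b
  have h6 : Real.exp (a - b) ≤ 1 := Real.exp_le_one_iff.2 (by linarith)
  nlinarith

theorem lipschitzWith_generator (hγ : IsConeGenerator γ l) : LipschitzWith 1 γ :=
  lipschitzWith_of_nnnorm_deriv_le (hγ.smooth.differentiable (by simp)) fun θ => by
    have := hγ.unit_speed θ
    rw [← NNReal.coe_le_coe]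
    simp [this]

/-- Freezing at `T < 0` keeps the argument of `u` in a compact part `K` of the open cone, whence
boundedness and uniform continuity. Test functions supported in `t < T` do not see the freezing. -/
theorem isModel_model (hγ : IsConeGenerator γ l) {u : EuclideanSpace ℝ (Fin n) → ℝ}
    (hu : ContinuousOn u (coneBall γ 1)) (hu0 : ∀ x ∈ coneBall γ 1, 0 ≤ u x)
    (hus : IsSubharmonic γ l u) {T : ℝ} (hT : T < 0) : ∃ M, IsModel (model γ u T) l T M := by
  set K : Set (EuclideanSpace ℝ (Fin n)) :=
    (fun z : ℝ × ℝ => z.1 • γ z.2) '' (Icc 0 (Real.exp T) ×ˢ Icc 0 l) with hK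
  have hKc : IsCompact K := (isCompact_Icc.prod isCompact_Icc).image
    (continuous_fst.smul (hγ.smooth.continuous.comp continuous_snd))
  have hKsub : K ⊆ coneBall γ 1 := by
    rintro _ ⟨z, hz, rfl⟩
    exact smul_mem_coneBall hγ hz.1.1 (hz.1.2.trans_lt (Real.exp_lt_one_iff.2 hT)) _
  set X : ℝ × ℝ → EuclideanSpace ℝ (Fin n) := fun w => Real.exp (min w.1 T) • γ w.2 with hX
  have hXK : ∀ w, X w ∈ K := fun w => by
    obtain ⟨y, hy, he⟩ := hγ.periodic.exists_mem_Ico₀ hγ.length_pos w.2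
    exact ⟨(Real.exp (min w.1 T), y), ⟨⟨(Real.exp_pos _).le, Real.exp_le_exp.2 (min_le_right _ _)⟩,
      Ico_subset_Icc_self hy⟩, by simp only [hX, he]⟩
  have hXu : UniformContinuous X := by
    -- One unit comes from the radial factor, as `exp` is 1-Lipschitz on `t ≤ 0`, and one from the
    -- unit speed curve.
    refine (LipschitzWith.of_dist_le_mul (K := 2) fun w w' => ?_).uniformContinuous
    have h1 : |Real.exp (min w.1 T) - Real.exp (min w'.1 T)| ≤ dist w w' :=
      calc _ ≤ |min w.1 T - min w'.1 T| := abs_exp_sub_exp_le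
            ((min_le_right _ _).trans hT.le) ((min_le_right _ _).trans hT.le)
        _ ≤ |w.1 - w'.1| := by
            simpa using abs_min_sub_min_le_max w.1 T w'.1 T
        _ ≤ dist w w' := by rw [← Real.dist_eq]; exact le_max_left _ _
    have h2 : ‖γ w.2 - γ w'.2‖ ≤ dist w w' := by
      rw [← dist_eq_norm]
      refine ((lipschitzWith_generator hγ).dist_le_mul _ _).trans ?_
      rw [NNReal.coe_one, one_mul]
      exact le_max_right _ _
    have h3 : Real.exp (min w'.1 T) ≤ 1 := Real.exp_le_one_iff.2 ((min_le_right _ _).trans hT.le)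
    have e : X w - X w' = (Real.exp (min w.1 T) - Real.exp (min w'.1 T)) • γ w.2 +
        Real.exp (min w'.1 T) • (γ w.2 - γ w'.2) := by
      simp only [hX, sub_smul, smul_sub]; abel
    rw [dist_eq_norm, e]
    refine (norm_add_le _ _).trans ?_
    rw [norm_smul, norm_smul, hγ.norm_eq_one, mul_one, Real.norm_eq_abs, Real.norm_eq_abs,
      abs_of_pos (Real.exp_pos _)]
    have h4 := mul_le_mul h3 h2 (norm_nonneg _) zero_le_one
    push_cast
    linarith
  have huu : UniformContinuousOn u K :=
    hKc.uniformContinuousOn_of_continuous (hu.mono hKsub)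
  obtain ⟨M, hM⟩ := hKc.exists_bound_of_continuousOn (hu.mono hKsub)
  refine ⟨M, ⟨?_, fun t θ => by simp only [model, hγ.periodic θ], fun w => hu0 _ (hKsub (hXK w)),
    fun w => hM _ (hXK w), ?_⟩⟩
  · rw [Metric.uniformContinuous_iff]
    intro ε hε
    obtain ⟨δ, hδ, h⟩ := Metric.uniformContinuousOn_iff.1 huu ε hε
    obtain ⟨δ', hδ', h'⟩ := Metric.uniformContinuous_iff.1 hXu δ hδ
    exact ⟨δ', hδ', fun {a b} hab => h _ (hXK a) _ (hXK b) (h' hab)⟩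
  · intro ψ hψ hc hsub hψ0
    have hT0 : tsupport ψ ⊆ {z | z.1 < 0} := fun z hz => lt_trans (hsub hz) hT
    have htest := isTest_pushTest hψ hc hT0
    have h := hus.laplacian_nonneg _ htest fun z => by
      unfold pushTest
      split_ifs
      exacts [hψ0 _, le_rfl]
    rw [integral_eq_integral_expFst] at h
    · refine h.trans_eq (integral_congr_ae (Filter.Eventually.of_forall fun w => ?_))
      have h1 := lap_comp_expFst htest.smooth w
      simp only [pushTest_expFst] at h1
      simp only
      by_cases hw : w ∈ tsupport ψ
      · have h2 : model γ u T w = polar γ u (expFst w) := by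
          have : w.1 < T := hsub hw
          simp [model, polar, expFst, min_eq_left this.le]
        rw [h2, show lap ψ w = _ from h1]
        simp only [expFst]
        ring
      · have h2 := lap_eq_zero_of_notMem hw
        rw [show lap ψ w = _ from h1] at h2
        have h3 := (mul_eq_zero.1 h2).resolve_left (by positivity)
        rw [h3, show lap ψ w = _ from h1, h3]
        ring
    · intro z hz
      have : z ∉ tsupport (pushTest ψ) := fun h => by
        exact absurd (htest.support_subset h).1.1 (not_lt.2 hz)
      rw [polarLaplacian_eq_zero_of_notMem this]
      ring

/-! ### Representing functions of distributions -/

/-- On the set `Ω` the functional `Λ` on test functions is represented by the locally integrable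
function `g`. -/
structure Represents (Ω : Set (ℝ × ℝ)) (Λ : (ℝ × ℝ → ℝ) → ℝ) (g : ℝ × ℝ → ℝ) : Prop where
  locallyIntegrable : LocallyIntegrableOn g Ω
  eq_integral : ∀ φ : ℝ × ℝ → ℝ, ContDiff ℝ ∞ φ → HasCompactSupport φ → tsupport φ ⊆ Ω →
    Λ φ = ∫ z, g z * φ z

theorem integrable_mul_test {Ω : Set (ℝ × ℝ)} {g φ : ℝ × ℝ → ℝ} (hg : LocallyIntegrableOn g Ω)
    (hφ : Continuous φ) (hc : HasCompactSupport φ) (hsub : tsupport φ ⊆ Ω) :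
    Integrable fun z => g z * φ z := by
  have h1 : IntegrableOn (fun z => g z * φ z) (tsupport φ) :=
    (hg.integrableOn_compact_subset hsub hc).mul_continuousOn hφ.continuousOn hc
  rw [← integrableOn_iff_integrable_of_support_subset (s := tsupport φ)]
  · exact h1
  · exact (Function.support_mul_subset_right _ _).trans (subset_tsupport φ)

theorem Represents.mono {Ω Ω' : Set (ℝ × ℝ)} {Λ : (ℝ × ℝ → ℝ) → ℝ} {g : ℝ × ℝ → ℝ}
    (h : Represents Ω Λ g) (hsub : Ω' ⊆ Ω) : Represents Ω' Λ g :=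
  ⟨h.locallyIntegrable.mono_set hsub,
    fun φ hφ hc hs => h.eq_integral φ hφ hc (hs.trans hsub)⟩

theorem Represents.ae_eq {Ω : Set (ℝ × ℝ)} (hΩ : IsOpen Ω) {Λ : (ℝ × ℝ → ℝ) → ℝ}
    {g g' : ℝ × ℝ → ℝ} (h : Represents Ω Λ g) (h' : Represents Ω Λ g') :
    ∀ᵐ z, z ∈ Ω → g z = g' z := by
  have := hΩ.ae_eq_zero_of_integral_contDiff_smul_eq_zero (μ := volume)
    (h.locallyIntegrable.sub h'.locallyIntegrable) fun φ hφ hc hs => by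
      have h1 := integrable_mul_test h.locallyIntegrable hφ.continuous hc hs
      have h2 := integrable_mul_test h'.locallyIntegrable hφ.continuous hc hs
      have h3 : ∫ z, φ z • (g z - g' z) = ∫ z, (g z * φ z - g' z * φ z) :=
        integral_congr_ae (Filter.Eventually.of_forall fun z => by
          simp only [smul_eq_mul]; ring)
      have h4 : ∫ z, φ z • (g - g') z = ∫ z, (g z * φ z - g' z * φ z) := h3
      rw [h4, integral_sub h1 h2, ← h.eq_integral φ hφ hc hs, ← h'.eq_integral φ hφ hc hs, sub_self]
  filter_upwards [this] with z hz hzΩ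
  exact sub_eq_zero.1 (hz hzΩ)

open Classical in
/-- Representing functions on an increasing sequence of open sets can be glued. -/
theorem exists_represents_iUnion {Ω : ℕ → Set (ℝ × ℝ)} (hΩ : ∀ j, IsOpen (Ω j)) (hmono : Monotone Ω)
    {Λ : (ℝ × ℝ → ℝ) → ℝ} (h : ∀ j, ∃ g, Represents (Ω j) Λ g) :
    ∃ g, Represents (⋃ j, Ω j) Λ g := by
  choose G hG using h
  -- The value is taken from the first set that contains `z`; by a.e. uniqueness on each of
  -- countably many sets this agrees a.e. with every later choice.
  set g : ℝ × ℝ → ℝ := fun z => if hz : ∃ j, z ∈ Ω j then G (Nat.find hz) z else 0 with hg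
  have hae : ∀ j, ∀ᵐ z, z ∈ Ω j → g z = G j z := by
    intro j
    have h1 : ∀ᵐ z, ∀ i, i ≤ j → z ∈ Ω i → G i z = G j z := by
      rw [ae_all_iff]
      intro i
      by_cases hij : i ≤ j
      · filter_upwards [(hG i).ae_eq (hΩ i) ((hG j).mono (hmono hij))] with z hz _ using hz
      · exact Filter.Eventually.of_forall fun z hz => absurd hz hij
    filter_upwards [h1] with z hz hzj
    have hex : ∃ j, z ∈ Ω j := ⟨j, hzj⟩
    simp only [hg, dif_pos hex]
    exact hz _ (Nat.find_min' hex hzj) (Nat.find_spec hex)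
  refine ⟨g, fun z hz => ?_, fun φ hφ hc hs => ?_⟩
  · obtain ⟨j, hj⟩ := mem_iUnion.1 hz
    obtain ⟨V, hV, hi⟩ := (hG j).locallyIntegrable z hj
    rw [(hΩ j).nhdsWithin_eq hj] at hV
    refine ⟨V ∩ Ω j, mem_nhdsWithin_of_mem_nhds
      (Filter.inter_mem hV ((hΩ j).mem_nhds hj)), ?_⟩
    have hi' : IntegrableOn (G j) (Ω j ∩ V) := hi.mono_set inter_subset_right
    rw [inter_comm]
    refine hi'.congr ?_
    have h2 : ∀ᵐ z ∂(volume.restrict (Ω j)), G j z = g z :=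
      (ae_restrict_iff' (hΩ j).measurableSet).2 (by
        filter_upwards [hae j] with z hz hzj using (hz hzj).symm)
    exact ae_mono (Measure.restrict_mono inter_subset_left le_rfl) h2
  · obtain ⟨j, hj⟩ := IsCompact.elim_directed_cover hc Ω hΩ hs hmono.directed_le
    rw [(hG j).eq_integral φ hφ hc hj]
    refine integral_congr_ae ?_
    filter_upwards [hae j] with z hz
    by_cases hzφ : z ∈ tsupport φ
    · rw [hz (hj hzφ)]
    · simp [image_eq_zero_of_notMem_tsupport hzφ]

/-! ### Limits in `L²` -/

/-- Completeness of `L²`. Convergence of the squares transfers energies to the limit; convergence of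
the pairings transfers integration by parts. -/
theorem exists_L2_limit {α : Type*} [MeasurableSpace α] {μ : Measure α} {F : ℕ → α → ℝ}
    (hF : ∀ k, MemLp (F k) 2 μ)
    (hC : ∀ ε > 0, ∃ N, ∀ m ≥ N, ∀ n ≥ N, ∫ z, (F m z - F n z) ^ 2 ∂μ ≤ ε) :
    ∃ H, MemLp H 2 μ ∧
      Filter.Tendsto (fun k => ∫ z, F k z ^ 2 ∂μ) Filter.atTop (nhds (∫ z, H z ^ 2 ∂μ)) ∧
      ∀ ψ, MemLp ψ 2 μ → Filter.Tendsto (fun k => ∫ z, F k z * ψ z ∂μ) Filter.atTop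
        (nhds (∫ z, H z * ψ z ∂μ)) := by
  set A : ℕ → Lp ℝ 2 μ := fun k => (hF k).toLp (F k) with hA
  have hinner : ∀ (X : Lp ℝ 2 μ) (f ψ : α → ℝ) (hψ : MemLp ψ 2 μ), X =ᵐ[μ] f →
      inner ℝ X (hψ.toLp ψ) = ∫ z, f z * ψ z ∂μ := by
    intro X f ψ hψ hX
    rw [L2.inner_def]
    refine integral_congr_ae ?_
    filter_upwards [hX, hψ.coeFn_toLp] with z h1 h2
    rw [h1, h2, real_inner_eq_re_inner, RCLike.inner_apply]
    simp [mul_comm]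
  have hcau : CauchySeq A := by
    rw [Metric.cauchySeq_iff]
    intro ε hε
    obtain ⟨N, hN⟩ := hC ((ε / 2) ^ 2) (by positivity)
    refine ⟨N, fun m hm n hn => ?_⟩
    have h1 : A m - A n = ((hF m).sub (hF n)).toLp (F m - F n) := (MemLp.toLp_sub _ _).symm
    have h2 : ‖A m - A n‖ ^ 2 ≤ (ε / 2) ^ 2 := by
      rw [← real_inner_self_eq_norm_sq, h1, hinner _ (F m - F n) _ _ (MemLp.coeFn_toLp _)]
      refine le_trans (le_of_eq ?_) (hN m hm n hn)
      exact integral_congr_ae (Filter.Eventually.of_forall fun z => by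
        simp only [Pi.sub_apply]; ring)
    rw [dist_eq_norm]
    have h3 := abs_le_of_sq_le_sq h2 (by positivity)
    linarith [le_abs_self ‖A m - A n‖]
  obtain ⟨X, hX⟩ := cauchySeq_tendsto_of_complete hcau
  refine ⟨X, Lp.memLp X, ?_, fun ψ hψ => ?_⟩
  · have h1 := hX.inner (𝕜 := ℝ) hX
    have h2 : inner ℝ X X = ∫ z, X z ^ 2 ∂μ := by
      have := hinner X X X (Lp.memLp X) (Filter.EventuallyEq.refl _ _)
      rw [Lp.toLp_coeFn] at this
      rw [this]
      exact integral_congr_ae (Filter.Eventually.of_forall fun z => (sq _).symm)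
    rw [h2] at h1
    refine h1.congr fun k => ?_
    rw [hinner (A k) (F k) (F k) (hF k) (MemLp.coeFn_toLp _)]
    exact integral_congr_ae (Filter.Eventually.of_forall fun z => (sq _).symm)
  · have h1 := hX.inner (𝕜 := ℝ) (tendsto_const_nhds (x := hψ.toLp ψ))
    rw [hinner X X ψ hψ (Filter.EventuallyEq.refl _ _)] at h1
    exact h1.congr fun k => hinner (A k) (F k) ψ hψ (MemLp.coeFn_toLp _)

/-! ### The weak gradient as a limit of gradients -/

theorem integral_mul_dr {g ψ : ℝ × ℝ → ℝ} (hg : ContDiff ℝ ∞ g) (hψ : ContDiff ℝ ∞ ψ)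
    (hc : HasCompactSupport ψ) : ∫ z, g z * dr ψ z = -∫ z, dr g z * ψ z :=
  integral_mul_fderiv_eq_neg_fderiv_mul_of_integrable
    (((contDiff_dr hg).continuous.mul hψ.continuous).integrable_of_hasCompactSupport hc.mul_left)
    ((hg.continuous.mul (contDiff_dr hψ).continuous).integrable_of_hasCompactSupport
      (hasCompactSupport_dr hc).mul_left)
    ((hg.continuous.mul hψ.continuous).integrable_of_hasCompactSupport hc.mul_left)
    (fun _ _ => hg.differentiable (by simp) _) (fun _ _ => hψ.differentiable (by simp) _)

theorem integral_mul_dθ {g ψ : ℝ × ℝ → ℝ} (hg : ContDiff ℝ ∞ g) (hψ : ContDiff ℝ ∞ ψ)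
    (hc : HasCompactSupport ψ) : ∫ z, g z * dθ ψ z = -∫ z, dθ g z * ψ z :=
  integral_mul_fderiv_eq_neg_fderiv_mul_of_integrable
    (((contDiff_dθ hg).continuous.mul hψ.continuous).integrable_of_hasCompactSupport hc.mul_left)
    ((hg.continuous.mul (contDiff_dθ hψ).continuous).integrable_of_hasCompactSupport
      (hasCompactSupport_dθ hc).mul_left)
    ((hg.continuous.mul hψ.continuous).integrable_of_hasCompactSupport hc.mul_left)
    (fun _ _ => hg.differentiable (by simp) _) (fun _ _ => hψ.differentiable (by simp) _)

theorem tendsto_integral_mul_of_uniform {f : ℝ × ℝ → ℝ} {g : ℕ → ℝ × ℝ → ℝ} {δ : ℕ → ℝ}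
    (hf : Continuous f) (hg : ∀ k, Continuous (g k)) (hfg : ∀ k z, |g k z - f z| ≤ δ k)
    (hδ : Filter.Tendsto δ Filter.atTop (nhds 0)) {χ : ℝ × ℝ → ℝ} (hχ : Continuous χ)
    (hc : HasCompactSupport χ) :
    Filter.Tendsto (fun k => ∫ z, g k z * χ z) Filter.atTop (nhds (∫ z, f z * χ z)) := by
  have hint : ∀ h : ℝ × ℝ → ℝ, Continuous h → Integrable fun z => h z * χ z := fun h hh =>
    (hh.mul hχ).integrable_of_hasCompactSupport hc.mul_left
  rw [tendsto_iff_norm_sub_tendsto_zero]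
  have hlim : Filter.Tendsto (fun k => δ k * ∫ z, |χ z|) Filter.atTop (nhds 0) := by
    simpa using hδ.mul_const (∫ z, |χ z|)
  refine squeeze_zero (fun _ => norm_nonneg _) (fun k => ?_) hlim
  rw [← integral_sub (hint _ (hg k)) (hint _ hf), ← integral_const_mul]
  refine norm_integral_le_of_norm_le
    ((hχ.abs.integrable_of_hasCompactSupport hc.abs).const_mul _)
    (Filter.Eventually.of_forall fun z => ?_)
  rw [← sub_mul, norm_mul, Real.norm_eq_abs, Real.norm_eq_abs]
  exact mul_le_mul_of_nonneg_right (hfg k z) (abs_nonneg _)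

theorem dr_sub {φ ψ : ℝ × ℝ → ℝ} (hφ : ContDiff ℝ ∞ φ) (hψ : ContDiff ℝ ∞ ψ) :
    dr (fun z => φ z - ψ z) = fun z => dr φ z - dr ψ z := by
  ext ⟨t, θ⟩
  exact dr_eq_of_hasDerivAt ((hφ.sub hψ).differentiable (by simp) _)
    ((ContDiff.dr_slice hφ t θ).sub (ContDiff.dr_slice hψ t θ))

theorem dθ_sub {φ ψ : ℝ × ℝ → ℝ} (hφ : ContDiff ℝ ∞ φ) (hψ : ContDiff ℝ ∞ ψ) :
    dθ (fun z => φ z - ψ z) = fun z => dθ φ z - dθ ψ z := by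
  ext ⟨t, θ⟩
  exact dθ_eq_of_hasDerivAt ((hφ.sub hψ).differentiable (by simp) _)
    ((ContDiff.dθ_slice hφ t θ).sub (ContDiff.dθ_slice hψ t θ))

theorem memLp_two_of_gsq {g : ℝ × ℝ → ℝ} (hg : ContDiff ℝ ∞ g) {A : Set (ℝ × ℝ)}
    (h : IntegrableOn (gsq g) A) :
    MemLp (dr g) 2 (volume.restrict A) ∧ MemLp (dθ g) 2 (volume.restrict A) := by
  have h1 := (contDiff_dr hg).continuous
  have h2 := (contDiff_dθ hg).continuous
  refine ⟨(memLp_two_iff_integrable_sq h1.aestronglyMeasurable).2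
    (h.mono' (h1.pow 2).aestronglyMeasurable (Filter.Eventually.of_forall fun z => ?_)),
    (memLp_two_iff_integrable_sq h2.aestronglyMeasurable).2
    (h.mono' (h2.pow 2).aestronglyMeasurable (Filter.Eventually.of_forall fun z => ?_))⟩
  · rw [Real.norm_eq_abs, abs_of_nonneg (by positivity), gsq]
    linarith [sq_nonneg (dθ g z)]
  · rw [Real.norm_eq_abs, abs_of_nonneg (by positivity), gsq]
    linarith [sq_nonneg (dr g z)]

/-- The gradients of the approximants are Cauchy in `L²` by `IsApprox.energy_sub_le`. In the
integration by parts formula one side converges by uniform convergence of `g k` and the other by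
convergence in `L²`. -/
theorem exists_weak_gradient {f : ℝ × ℝ → ℝ} {g : ℕ → ℝ × ℝ → ℝ} {δ : ℕ → ℝ} {l L S M : ℝ}
    (hf : Continuous f) (hM : ∀ z, |f z| ≤ M) (hg : ∀ k, IsApprox f l S (δ k) (g k))
    (hδ : Filter.Tendsto δ Filter.atTop (nhds 0)) (hL : 0 < L)
    (hper : ∀ k, SndPeriodic L (g k)) {t : ℝ} (ht : t < S) (c : ℝ) :
    ∃ H₁ H₂ : ℝ × ℝ → ℝ, MemLp H₁ 2 (volume.restrict (strip c L t)) ∧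
      MemLp H₂ 2 (volume.restrict (strip c L t)) ∧
      Filter.Tendsto (fun k => ∫ z in strip c L t, gsq (g k) z) Filter.atTop
        (nhds (∫ z in strip c L t, (H₁ z ^ 2 + H₂ z ^ 2))) ∧
      ∀ ψ : ℝ × ℝ → ℝ, ContDiff ℝ ∞ ψ → HasCompactSupport ψ → tsupport ψ ⊆ strip c L t →
        ∫ z, f z * dr ψ z = -∫ z, H₁ z * ψ z ∧ ∫ z, f z * dθ ψ z = -∫ z, H₂ z * ψ z := by
  have hM0 : 0 ≤ M := (abs_nonneg _).trans (hM 0)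
  have hfin : ∀ k, IntegrableOn (gsq (g k)) (strip c L t) := fun k =>
    (IsApprox.energy_facts (f := f) (l := L) ⟨(hg k).smooth, hper k, (hg k).nonneg, (hg k).close,
      (hg k).subharmonic, (hg k).eq_zero⟩ hL hM ht c).1
  have hmem := fun k => memLp_two_of_gsq (hg k).smooth (hfin k)
  have hcau : ∀ ε > 0, ∃ N, ∀ m ≥ N, ∀ n ≥ N,
      IntegrableOn (gsq fun z => g m z - g n z) (strip c L t) ∧
      ∫ z in strip c L t, gsq (fun z => g m z - g n z) z ≤ ε := by
    intro ε hε
    set C := 4 * ((2 * M + 3) * L) / (S - t) with hC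
    have hC0 : 0 < C := by
      have : 0 < S - t := sub_pos.2 ht
      positivity
    -- `energy_sub_le` needs `η ≤ 1` and bounds the energy by `η C`.
    set η := min 1 (ε / C) with hη
    have hη0 : 0 < η := lt_min one_pos (by positivity)
    have hev : ∀ᶠ k in Filter.atTop, δ k < η / 2 := hδ.eventually_lt_const (by positivity)
    obtain ⟨N, hN⟩ := Filter.eventually_atTop.1 hev
    refine ⟨N, fun m hm n hn => ?_⟩
    have h1 := (hg m).energy_sub_le (hg n) hM hL (hper m) (hper n) (η := η)
      (by linarith [hN m hm, hN n hn]) (min_le_left _ _) ht c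
    refine ⟨h1.1, h1.2.trans ?_⟩
    calc 4 * (η * (2 * M + 3) * L) / (S - t) = η * C := by rw [hC]; ring
      _ ≤ ε / C * C := by gcongr; exact min_le_right _ _
      _ = ε := by field_simp
  have hcau1 : ∀ ε > 0, ∃ N, ∀ m ≥ N, ∀ n ≥ N,
      ∫ z in strip c L t, (dr (g m) z - dr (g n) z) ^ 2 ≤ ε := by
    intro ε hε
    obtain ⟨N, hN⟩ := hcau ε hε
    refine ⟨N, fun m hm n hn => le_trans ?_ (hN m hm n hn).2⟩
    refine integral_mono_of_nonneg (Filter.Eventually.of_forall fun z => sq_nonneg _)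
      (hN m hm n hn).1 (Filter.Eventually.of_forall fun z => ?_)
    simp only [gsq, dr_sub (hg m).smooth (hg n).smooth]
    exact le_add_of_nonneg_right (sq_nonneg _)
  have hcau2 : ∀ ε > 0, ∃ N, ∀ m ≥ N, ∀ n ≥ N,
      ∫ z in strip c L t, (dθ (g m) z - dθ (g n) z) ^ 2 ≤ ε := by
    intro ε hε
    obtain ⟨N, hN⟩ := hcau ε hε
    refine ⟨N, fun m hm n hn => le_trans ?_ (hN m hm n hn).2⟩
    refine integral_mono_of_nonneg (Filter.Eventually.of_forall fun z => sq_nonneg _)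
      (hN m hm n hn).1 (Filter.Eventually.of_forall fun z => ?_)
    simp only [gsq, dθ_sub (hg m).smooth (hg n).smooth]
    exact le_add_of_nonneg_left (sq_nonneg _)
  obtain ⟨H₁, hH₁, hsq1, hw1⟩ := exists_L2_limit (fun k => (hmem k).1) hcau1
  obtain ⟨H₂, hH₂, hsq2, hw2⟩ := exists_L2_limit (fun k => (hmem k).2) hcau2
  refine ⟨H₁, H₂, hH₁, hH₂, ?_, fun ψ hψ hc hs => ?_⟩
  · rw [integral_add hH₁.integrable_sq hH₂.integrable_sq]
    refine (hsq1.add hsq2).congr fun k => ?_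
    rw [← integral_add (hmem k).1.integrable_sq (hmem k).2.integrable_sq]
    rfl
  · have hψL : MemLp ψ 2 (volume.restrict (strip c L t)) :=
      (hψ.continuous.memLp_of_hasCompactSupport hc).restrict _
    have hset : ∀ h : ℝ × ℝ → ℝ, ∫ z in strip c L t, h z * ψ z = ∫ z, h z * ψ z := fun h =>
      setIntegral_eq_integral_of_forall_compl_eq_zero fun z hz => by
        rw [image_eq_zero_of_notMem_tsupport fun h => hz (hs h), mul_zero]
    constructor
    · have h1 := tendsto_integral_mul_of_uniform hf (fun k => (hg k).smooth.continuous)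
        (fun k => (hg k).close) hδ (contDiff_dr hψ).continuous (hasCompactSupport_dr hc)
      have h2 := (hw1 ψ hψL).neg
      rw [hset] at h2
      refine tendsto_nhds_unique h1 (h2.congr fun k => ?_)
      rw [hset, integral_mul_dr (hg k).smooth hψ hc]
    · have h1 := tendsto_integral_mul_of_uniform hf (fun k => (hg k).smooth.continuous)
        (fun k => (hg k).close) hδ (contDiff_dθ hψ).continuous (hasCompactSupport_dθ hc)
      have h2 := (hw2 ψ hψL).neg
      rw [hset] at h2
      refine tendsto_nhds_unique h1 (h2.congr fun k => ?_)
      rw [hset, integral_mul_dθ (hg k).smooth hψ hc]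

/-! ### The weak partial derivatives in polar coordinates -/

/-- The open set `0 < r < R`, `c < θ < c + L`. -/
def openSector (R c L : ℝ) : Set (ℝ × ℝ) := Ioo 0 R ×ˢ Ioo c (c + L)

theorem isOpen_openSector (R c L : ℝ) : IsOpen (openSector R c L) := isOpen_Ioo.prod isOpen_Ioo

/-- Near a point of the sector `r` is bounded below, so only boxes bounded in `t` matter; there `L²`
functions are integrable, unlike on the whole half strip. -/
theorem locallyIntegrableOn_openSector {t c L : ℝ} {G : ℝ × ℝ → ℝ} (h : ∀ a : ℝ,
    IntegrableOn (fun w => Real.exp w.1 * G (expFst w)) (Ioo a t ×ˢ Ioo c (c + L))) :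
    LocallyIntegrableOn G (openSector (Real.exp t) c L) := by
  intro z hz
  have hz0 : 0 < z.1 := hz.1.1
  refine ⟨openSector (Real.exp t) c L ∩ {y | z.1 / 2 < y.1}, Filter.inter_mem
    self_mem_nhdsWithin (mem_nhdsWithin_of_mem_nhds
      ((isOpen_lt continuous_const continuous_fst).mem_nhds (by simpa using hz0))), ?_⟩
  refine ((integrableOn_image_expFst (measurableSet_Ioo.prod measurableSet_Ioo) G).2
    (h (Real.log (z.1 / 2)))).mono_set ?_
  rintro y ⟨⟨⟨h0, h1⟩, h2⟩, h3⟩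
  exact ⟨logFst y, ⟨⟨Real.log_lt_log (by positivity) h3, (Real.log_lt_iff_lt_exp h0).2 h1⟩, h2⟩,
    expFst_logFst h0⟩

theorem integrableOn_box_of_memLp {H : ℝ × ℝ → ℝ} {c L t : ℝ}
    (hH : MemLp H 2 (volume.restrict (strip c L t))) (a : ℝ) :
    IntegrableOn H (Ioo a t ×ˢ Ioo c (c + L)) := by
  have hsub : Ioo a t ×ˢ Ioo c (c + L) ⊆ strip c L t :=
    prod_mono Ioo_subset_Iio_self Ioo_subset_Ioc_self
  have hfin : IsFiniteMeasure ((volume : Measure (ℝ × ℝ)).restrict (Ioo a t ×ˢ Ioo c (c + L))) :=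
    isFiniteMeasure_restrict.2 (by
      rw [Measure.volume_eq_prod, Measure.prod_prod]
      exact ENNReal.mul_ne_top (by simp) (by simp))
  exact (hH.mono_measure (Measure.restrict_mono hsub le_rfl)).integrable one_le_two

theorem tsupport_comp_expFst_subset (φ : ℝ × ℝ → ℝ) :
    tsupport (fun w => φ (expFst w)) ⊆ expFst ⁻¹' tsupport φ :=
  closure_minimal (fun _ hw => subset_closure hw)
    ((isClosed_tsupport φ).preimage contDiff_expFst.continuous)

theorem hasCompactSupport_comp_expFst {φ : ℝ × ℝ → ℝ} (hc : HasCompactSupport φ)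
    (hs : tsupport φ ⊆ {z | 0 < z.1}) : HasCompactSupport fun w => φ (expFst w) :=
  (IsCompact.image_of_continuousOn hc (continuousOn_logFst.mono hs)).of_isClosed_subset
    (isClosed_tsupport _) fun w hw =>
      ⟨expFst w, tsupport_comp_expFst_subset φ hw, logFst_expFst w⟩

/-- The distributional partial derivative in `r` of a function on the cone. -/
noncomputable def distDr (γ : ℝ → EuclideanSpace ℝ (Fin n)) (u : EuclideanSpace ℝ (Fin n) → ℝ)
    (φ : ℝ × ℝ → ℝ) : ℝ := -∫ z, polar γ u z * dr φ z

/-- The distributional partial derivative in `θ` of a function on the cone. -/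
noncomputable def distDθ (γ : ℝ → EuclideanSpace ℝ (Fin n)) (u : EuclideanSpace ℝ (Fin n) → ℝ)
    (φ : ℝ × ℝ → ℝ) : ℝ := -∫ z, polar γ u z * dθ φ z

/-- Since `∂_t = r ∂_r`, the weak gradient `(H₁, H₂)` on the cylinder becomes `(H₁/r, H₂)` on the
cone, and `(G₁² + G₂²/r²) r dr dθ = (H₁² + H₂²) dt dθ`. -/
theorem exists_local_partials {u : EuclideanSpace ℝ (Fin n) → ℝ} {g : ℕ → ℝ × ℝ → ℝ}
    {δ : ℕ → ℝ} {L S T M : ℝ} (hf : IsModel (model γ u T) l T M) (hST : S ≤ T)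
    (hg : ∀ k, IsApprox (model γ u T) l S (δ k) (g k))
    (hδ : Filter.Tendsto δ Filter.atTop (nhds 0)) (hL : 0 < L)
    (hper : ∀ k, SndPeriodic L (g k)) {t : ℝ} (ht : t < S) (c : ℝ) :
    ∃ G₁ G₂ : ℝ × ℝ → ℝ, Represents (openSector (Real.exp t) c L) (distDr γ u) G₁ ∧
      Represents (openSector (Real.exp t) c L) (distDθ γ u) G₂ ∧
      IntegrableOn (fun z => (G₁ z ^ 2 + G₂ z ^ 2 / z.1 ^ 2) * z.1) (expFst '' strip c L t) ∧
      Filter.Tendsto (fun k => ∫ z in strip c L t, gsq (g k) z) Filter.atTop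
        (nhds (∫ z in expFst '' strip c L t, (G₁ z ^ 2 + G₂ z ^ 2 / z.1 ^ 2) * z.1)) := by
  obtain ⟨H₁, H₂, hH₁, hH₂, hlim, hweak⟩ := exists_weak_gradient
    hf.uniformContinuous.continuous hf.bound hg hδ hL hper ht c
  set G₁ : ℝ × ℝ → ℝ := fun z => H₁ (logFst z) / z.1 with hG₁
  set G₂ : ℝ × ℝ → ℝ := fun z => H₂ (logFst z) with hG₂
  have hexp : ∀ w : ℝ × ℝ, Real.exp w.1 ≠ 0 := fun w => (Real.exp_pos _).ne'
  have hE₁ : ∀ w, Real.exp w.1 * G₁ (expFst w) = H₁ w := fun w => by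
    simp only [hG₁, logFst_expFst]
    exact mul_div_cancel₀ _ (hexp w)
  have hE₂ : ∀ w, G₂ (expFst w) = H₂ w := fun w => by simp only [hG₂, logFst_expFst]
  have hE : ∀ w, Real.exp w.1 * ((G₁ (expFst w) ^ 2 + G₂ (expFst w) ^ 2 / (expFst w).1 ^ 2) *
      (expFst w).1) = H₁ w ^ 2 + H₂ w ^ 2 := fun w => by
    rw [← hE₁, ← hE₂]
    have := hexp w
    simp only [show (expFst w).1 = Real.exp w.1 from rfl]
    field_simp
  have htest : ∀ φ : ℝ × ℝ → ℝ, ContDiff ℝ ∞ φ → HasCompactSupport φ →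
      tsupport φ ⊆ openSector (Real.exp t) c L → ContDiff ℝ ∞ (fun w => φ (expFst w)) ∧
      HasCompactSupport (fun w => φ (expFst w)) ∧
      tsupport (fun w => φ (expFst w)) ⊆ strip c L t ∧
      (∀ z : ℝ × ℝ, z.1 ≤ 0 → z ∉ tsupport φ) ∧
      ∀ w, expFst w ∈ tsupport φ → polar γ u (expFst w) = model γ u T w := by
    intro φ hφ hc hs
    have hpos : ∀ z ∈ tsupport φ, 0 < z.1 := fun z hz => (hs hz).1.1
    refine ⟨hφ.comp contDiff_expFst, hasCompactSupport_comp_expFst hc hpos, fun w hw => ?_,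
      fun z hz h => absurd (hpos z h) (not_lt.2 hz), fun w hw => ?_⟩
    · have h := hs (tsupport_comp_expFst_subset φ hw)
      exact ⟨Real.exp_lt_exp.1 h.1.2, Ioo_subset_Ioc_self h.2⟩
    · have h : w.1 < t := Real.exp_lt_exp.1 (hs hw).1.2
      simp [model, polar, expFst, min_eq_left (show w.1 ≤ T by linarith)]
  refine ⟨G₁, G₂, ⟨locallyIntegrableOn_openSector fun a => ?_, fun φ hφ hc hs => ?_⟩,
    ⟨locallyIntegrableOn_openSector fun a => ?_, fun φ hφ hc hs => ?_⟩, ?_, ?_⟩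
  · simp only [hE₁]
    exact integrableOn_box_of_memLp hH₁ a
  · obtain ⟨h1, h2, h3, h4, h5⟩ := htest φ hφ hc hs
    have hw := (hweak _ h1 h2 h3).1
    rw [distDr, integral_eq_integral_expFst (F := fun z => polar γ u z * dr φ z)
        (fun z hz => by rw [dr_eq_zero_of_notMem (h4 z hz), mul_zero]),
      integral_eq_integral_expFst (F := fun z => G₁ z * φ z)
        (fun z hz => by rw [image_eq_zero_of_notMem_tsupport (h4 z hz), mul_zero]), neg_eq_iff_eq_neg]
    simp only [← mul_assoc, hE₁]
    rw [← hw, dr_comp_expFst hφ]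
    refine integral_congr_ae (Filter.Eventually.of_forall fun w => ?_)
    simp only
    by_cases hwφ : expFst w ∈ tsupport φ
    · rw [h5 w hwφ]; ring
    · rw [dr_eq_zero_of_notMem hwφ]; ring
  · simp only [hE₂]
    refine (integrableOn_box_of_memLp hH₂ a).bdd_mul (c := Real.exp t)
      (Real.continuous_exp.comp continuous_fst).aestronglyMeasurable ?_
    refine (ae_restrict_iff' (measurableSet_Ioo.prod measurableSet_Ioo)).2
      (Filter.Eventually.of_forall fun w hw => ?_)
    simpa using hw.1.2.le
  · obtain ⟨h1, h2, h3, h4, h5⟩ := htest φ hφ hc hs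
    have he : ContDiff ℝ ∞ fun w : ℝ × ℝ => Real.exp w.1 := Real.contDiff_exp.comp contDiff_fst
    have hde : dθ (fun w : ℝ × ℝ => Real.exp w.1) = fun _ => 0 := funext fun w =>
      dθ_eq_of_hasDerivAt (t := w.1) (θ := w.2) (he.differentiable (by simp) _)
        (hasDerivAt_const w.2 (Real.exp w.1))
    -- In the radial case the Jacobian `eᵗ` is supplied by the chain rule. Here it is put into the
    -- test function, which is harmless because it does not depend on `θ`.
    have hw := (hweak (fun w => Real.exp w.1 * φ (expFst w)) (he.mul h1) h2.mul_left
      ((tsupport_mul_subset_right (f := fun w : ℝ × ℝ => Real.exp w.1)).trans h3)).2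
    rw [distDθ, integral_eq_integral_expFst (F := fun z => polar γ u z * dθ φ z)
        (fun z hz => by rw [dθ_eq_zero_of_notMem (h4 z hz), mul_zero]),
      integral_eq_integral_expFst (F := fun z => G₂ z * φ z)
        (fun z hz => by rw [image_eq_zero_of_notMem_tsupport (h4 z hz), mul_zero]), neg_eq_iff_eq_neg]
    simp only [hE₂]
    rw [dθ_mul he h1, hde, dθ_comp_expFst hφ] at hw
    refine Eq.trans ?_ (hw.trans ?_)
    · refine integral_congr_ae (Filter.Eventually.of_forall fun w => ?_)
      simp only
      by_cases hwφ : expFst w ∈ tsupport φ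
      · rw [h5 w hwφ]; ring
      · rw [dθ_eq_zero_of_notMem hwφ]; ring
    · exact congrArg Neg.neg (integral_congr_ae (Filter.Eventually.of_forall fun w => by
        simp only; ring))
  · rw [integrableOn_image_expFst (measurableSet_strip _ _ _)]
    simp only [hE]
    exact hH₁.integrable_sq.add hH₂.integrable_sq
  · rw [setIntegral_image_expFst (measurableSet_strip _ _ _)]
    simp only [hE]
    exact hlim

theorem represents_of_hasWeakPartials {u : EuclideanSpace ℝ (Fin n) → ℝ} {G : ℝ × ℝ → ℝ × ℝ}
    (h : HasWeakPartials (polar γ u) G) :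
    Represents unitCover (distDr γ u) (fun z => (G z).1) ∧
      Represents unitCover (distDθ γ u) (fun z => (G z).2) := by
  refine ⟨⟨fun z hz => ?_, fun φ hφ hc hs => ?_⟩, ⟨fun z hz => ?_, fun φ hφ hc hs => ?_⟩⟩
  · obtain ⟨V, hV, hi⟩ := h.locallyIntegrable z hz
    exact ⟨V, hV, hi.fst⟩
  · rw [distDr, h.radial φ ⟨hφ, hc, hs⟩, neg_neg]
  · obtain ⟨V, hV, hi⟩ := h.locallyIntegrable z hz
    exact ⟨V, hV, hi.snd⟩
  · rw [distDθ, h.angular φ ⟨hφ, hc, hs⟩, neg_neg]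

theorem weaklyDifferentiable_of_represents {u : EuclideanSpace ℝ (Fin n) → ℝ} {G₁ G₂ : ℝ × ℝ → ℝ}
    (h₁ : Represents unitCover (distDr γ u) G₁) (h₂ : Represents unitCover (distDθ γ u) G₂) :
    WeaklyDifferentiable (polar γ u) := by
  refine ⟨fun z => (G₁ z, G₂ z), fun z hz => ?_, fun φ hφ => ?_, fun φ hφ => ?_⟩
  · obtain ⟨V, hV, hi⟩ := h₁.locallyIntegrable z hz
    obtain ⟨V', hV', hi'⟩ := h₂.locallyIntegrable z hz
    exact ⟨V ∩ V', Filter.inter_mem hV hV',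
      Integrable.prodMk (hi.mono_set inter_subset_left) (hi'.mono_set inter_subset_right)⟩
  · rw [← h₁.eq_integral φ hφ.smooth hφ.compact hφ.support_subset, distDr, neg_neg]
  · rw [← h₂.eq_integral φ hφ.smooth hφ.compact hφ.support_subset, distDθ, neg_neg]

/-! ### Gluing, convergence of energies and the monotonicity formula -/

theorem IsModel.exists_approx_seq {f : ℝ × ℝ → ℝ} {l T M : ℝ} (h : IsModel f l T M) {S : ℝ}
    (hS : S < T) : ∃ (g : ℕ → ℝ × ℝ → ℝ) (δ : ℕ → ℝ), Filter.Tendsto δ Filter.atTop (nhds 0) ∧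
      ∀ k, IsApprox f l S (δ k) (g k) := by
  choose g hg using fun k : ℕ => h.exists_approx hS (Nat.one_div_pos_of_nat (α := ℝ) (n := k))
  exact ⟨g, _, tendsto_one_div_add_atTop_nhds_zero_nat, hg⟩

/-- Test functions on the covering may extend over many periods and close to `r = 1`. The covering
is therefore exhausted by sectors, each treated with its own frozen model, and the local gradients
are glued. -/
theorem weaklyDifferentiable_of_isSubharmonic (hγ : IsConeGenerator γ l)
    {u : EuclideanSpace ℝ (Fin n) → ℝ} (hu : ContinuousOn u (coneBall γ 1))
    (hu0 : ∀ x ∈ coneBall γ 1, 0 ≤ u x) (hus : IsSubharmonic γ l u) :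
    WeaklyDifferentiable (polar γ u) := by
  have hl := hγ.length_pos
  set ρ : ℕ → ℝ := fun j => -(1 / ((j : ℝ) + 1)) with hρ
  have hρ0 : ∀ j, ρ j < 0 := fun j => neg_lt_zero.2 Nat.one_div_pos_of_nat
  have hρmono : Monotone ρ := fun i j hij => neg_le_neg (Nat.one_div_le_one_div hij)
  -- The sector is `|θ| < (j + 1) l`; its width `2(j + 1) l` is a multiple of `l`, hence a period of
  -- the approximants.
  set Ω : ℕ → Set (ℝ × ℝ) := fun j =>
    openSector (Real.exp (ρ j)) (-((j + 1 : ℕ) * l)) ((2 * (j + 1) : ℕ) * l) with hΩ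
  have hloc : ∀ j, (∃ G, Represents (Ω j) (distDr γ u) G) ∧
      ∃ G, Represents (Ω j) (distDθ γ u) G := by
    intro j
    obtain ⟨S, hS1, hS2⟩ := exists_between (hρ0 j)
    obtain ⟨T, hT1, hT2⟩ := exists_between hS2
    obtain ⟨M, hM⟩ := isModel_model hγ hu hu0 hus hT2
    obtain ⟨g, δ, hδ, hg⟩ := hM.exists_approx_seq hT1
    obtain ⟨G₁, G₂, h1, h2, -⟩ := exists_local_partials (L := (2 * (j + 1) : ℕ) * l) hM hT1.le hg hδ
      (by positivity) (fun k => (hg k).periodic.nat_mul _) hS1 (-((j + 1 : ℕ) * l))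
    exact ⟨⟨G₁, h1⟩, ⟨G₂, h2⟩⟩
  have hopen : ∀ j, IsOpen (Ω j) := fun j => isOpen_openSector _ _ _
  have hmem : ∀ j z, z ∈ Ω j ↔
      (0 < z.1 ∧ z.1 < Real.exp (ρ j)) ∧ -((j + 1) * l) < z.2 ∧ z.2 < (j + 1) * l := by
    intro j z
    simp only [hΩ, openSector, mem_prod, mem_Ioo]
    push_cast
    rw [show -(((j : ℝ) + 1) * l) + 2 * ((j : ℝ) + 1) * l = (j + 1) * l by ring]
  have hmono : Monotone Ω := by
    intro i j hij z hz
    rw [hmem] at hz ⊢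
    have h1 : ((i : ℝ) + 1) * l ≤ (j + 1) * l := by gcongr
    have h2 := Real.exp_le_exp.2 (hρmono hij)
    exact ⟨⟨hz.1.1, hz.1.2.trans_le h2⟩, by linarith [hz.2.1], by linarith [hz.2.2]⟩
  have hunion : ⋃ j, Ω j = unitCover := by
    ext z
    rw [mem_iUnion]
    constructor
    · rintro ⟨j, hj⟩
      rw [hmem] at hj
      exact ⟨⟨hj.1.1, hj.1.2.trans (Real.exp_lt_one_iff.2 (hρ0 j))⟩, trivial⟩
    · rintro ⟨⟨h0, h1⟩, -⟩
      have hlog : Real.log z.1 < 0 := Real.log_neg h0 h1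
      have hρlim : Filter.Tendsto ρ Filter.atTop (nhds 0) := by
        simpa only [neg_zero] using (tendsto_one_div_add_atTop_nhds_zero_nat (𝕜 := ℝ)).neg
      obtain ⟨j, hj1, hj2⟩ := ((hρlim.eventually_const_lt hlog).and
        (tendsto_natCast_atTop_atTop.eventually_ge_atTop (|z.2| / l))).exists
      refine ⟨j, (hmem j z).2 ⟨⟨h0, (Real.log_lt_iff_lt_exp h0).1 hj1⟩, ?_⟩⟩
      rw [div_le_iff₀ hl] at hj2
      have := abs_le.1 hj2
      constructor <;> nlinarith
  obtain ⟨G₁, hG₁⟩ := exists_represents_iUnion hopen hmono fun j => (hloc j).1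
  obtain ⟨G₂, hG₂⟩ := exists_represents_iUnion hopen hmono fun j => (hloc j).2
  rw [hunion] at hG₁ hG₂
  exact weaklyDifferentiable_of_represents hG₁ hG₂

/-- The energy of a subharmonic function is the limit of the energies of its approximants. -/
theorem tendsto_energy (hγ : IsConeGenerator γ l) {u : EuclideanSpace ℝ (Fin n) → ℝ}
    (hw : WeaklyDifferentiable (polar γ u)) {g : ℕ → ℝ × ℝ → ℝ} {δ : ℕ → ℝ} {S T M : ℝ}
    (hf : IsModel (model γ u T) l T M) (hST : S ≤ T) (hT : T < 0)
    (hg : ∀ k, IsApprox (model γ u T) l S (δ k) (g k))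
    (hδ : Filter.Tendsto δ Filter.atTop (nhds 0)) {r : ℝ} (hr : 0 < r) (hrS : Real.log r < S) :
    IntegrableOn (fun z => gradSq γ u z * z.1) (sector l r) ∧
    Filter.Tendsto (fun k => energy l (g k) (Real.log r)) Filter.atTop
      (nhds (coneIntegral l r (gradSq γ u))) := by
  obtain ⟨G₁, G₂, h1, h2, hint, hlim⟩ := exists_local_partials hf hST hg hδ hγ.length_pos
    (fun k => (hg k).periodic) hrS 0
  rw [Real.exp_log hr] at h1 h2
  rw [image_expFst_strip hr] at hint hlim
  have hsub : openSector r 0 l ⊆ unitCover := fun z hz =>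
    ⟨⟨hz.1.1, hz.1.2.trans ((Real.log_neg_iff hr).1 (by linarith))⟩, trivial⟩
  -- `weakPartials` is an arbitrary choice of gradient; a.e. uniqueness identifies it with the limit
  -- constructed here.
  have hG : HasWeakPartials (polar γ u) (weakPartials (polar γ u)) := by
    rw [weakPartials, dif_pos hw]
    exact hw.choose_spec
  obtain ⟨k1, k2⟩ := represents_of_hasWeakPartials hG
  -- The sector contains the line `θ = l`, the open sector does not; the line is a null set.
  have hline : ∀ᵐ z : ℝ × ℝ, z.2 ≠ l :=
    (Measure.quasiMeasurePreserving_snd (μ := (volume : Measure ℝ)) (ν := (volume : Measure ℝ))).ae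
      (Measure.ae_ne volume l)
  have hae : ∀ᵐ z ∂(volume.restrict (sector l r)),
      (G₁ z ^ 2 + G₂ z ^ 2 / z.1 ^ 2) * z.1 = gradSq γ u z * z.1 := by
    refine (ae_restrict_iff' (measurableSet_Ioo.prod measurableSet_Ioc)).2 ?_
    filter_upwards [h1.ae_eq (isOpen_openSector _ _ _) (k1.mono hsub),
      h2.ae_eq (isOpen_openSector _ _ _) (k2.mono hsub), hline] with z e1 e2 hz hzs
    have hzo : z ∈ openSector r 0 l :=
      ⟨hzs.1, hzs.2.1, by simpa using lt_of_le_of_ne hzs.2.2 hz⟩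
    rw [gradSq, e1 hzo, e2 hzo]
  refine ⟨hint.congr hae, ?_⟩
  rw [integral_congr_ae hae] at hlim
  exact hlim

theorem hasLocallyFiniteEnergy_of_isSubharmonic (hγ : IsConeGenerator γ l)
    {u : EuclideanSpace ℝ (Fin n) → ℝ} (hu : ContinuousOn u (coneBall γ 1))
    (hu0 : ∀ x ∈ coneBall γ 1, 0 ≤ u x) (hus : IsSubharmonic γ l u) :
    HasLocallyFiniteEnergy γ l u := by
  have hw := weaklyDifferentiable_of_isSubharmonic hγ hu hu0 hus
  refine ⟨hw, fun r hr => ?_⟩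
  obtain ⟨S, hS1, hS2⟩ := exists_between (Real.log_neg hr.1 hr.2)
  obtain ⟨T, hT1, hT2⟩ := exists_between hS2
  obtain ⟨M, hM⟩ := isModel_model hγ hu hu0 hus hT2
  obtain ⟨g, δ, hδ, hg⟩ := hM.exists_approx_seq hT1
  exact (tendsto_energy hγ hw hM hT1.le hT2 hg hδ hr.1 hS1).1

/-- Both functions are approximated with the same levels `log r' < S < T < 0`. The product of the
approximate energies is monotone below `S` and converges at `r` and at `r'`. -/
theorem monotoneOn_acf (hγ : IsConeGenerator γ l) {α : ℝ} (hαl : α ≤ 4 * Real.pi / l)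
    {u v : EuclideanSpace ℝ (Fin n) → ℝ}
    (hu : ContinuousOn u (coneBall γ 1)) (hv : ContinuousOn v (coneBall γ 1))
    (hu0 : ∀ x ∈ coneBall γ 1, 0 ≤ u x) (hv0 : ∀ x ∈ coneBall γ 1, 0 ≤ v x)
    (hus : IsSubharmonic γ l u) (hvs : IsSubharmonic γ l v)
    (huv : ∀ x ∈ coneBall γ 1, u x * v x = 0) :
    MonotoneOn (acf γ l α u v) (Ioo 0 1) := by
  have hwu := weaklyDifferentiable_of_isSubharmonic hγ hu hu0 hus
  have hwv := weaklyDifferentiable_of_isSubharmonic hγ hv hv0 hvs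
  intro r hr r' hr' hrr'
  obtain ⟨S, hS1, hS2⟩ := exists_between (Real.log_neg hr'.1 hr'.2)
  obtain ⟨T, hT1, hT2⟩ := exists_between hS2
  obtain ⟨M, hM⟩ := isModel_model hγ hu hu0 hus hT2
  obtain ⟨M', hM'⟩ := isModel_model hγ hv hv0 hvs hT2
  obtain ⟨g, δ, hδ, hg⟩ := hM.exists_approx_seq hT1
  obtain ⟨g', δ', hδ', hg'⟩ := hM'.exists_approx_seq hT1
  have hdisj : ∀ w, model γ u T w * model γ v T w = 0 := fun w =>
    huv _ (smul_mem_coneBall hγ (Real.exp_pos _).le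
      (Real.exp_lt_one_iff.2 ((min_le_right _ _).trans_lt hT2)) _)
  have hlogle : Real.log r ≤ Real.log r' := Real.log_le_log hr.1 hrr'
  have hlim : ∀ s ∈ Ioo (0 : ℝ) 1, Real.log s < S → Filter.Tendsto
      (fun k => Real.exp (-(2 * α * Real.log s)) *
        (energy l (g k) (Real.log s) * energy l (g' k) (Real.log s)))
      Filter.atTop (nhds (acf γ l α u v s)) := fun s hs hsS => by
    have h1 := (tendsto_energy hγ hwu hM hT1.le hT2 hg hδ hs.1 hsS).2
    have h2 := (tendsto_energy hγ hwv hM' hT1.le hT2 hg' hδ' hs.1 hsS).2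
    have e : Real.exp (-(2 * α * Real.log s)) = 1 / s ^ (2 * α) := by
      rw [Real.rpow_def_of_pos hs.1, Real.exp_neg, one_div, mul_comm (Real.log s)]
    rw [e, acf, mul_assoc]
    exact (h1.mul h2).const_mul _
  refine le_of_tendsto_of_tendsto' (hlim r hr (hlogle.trans_lt hS1)) (hlim r' hr' hS1) fun k => ?_
  exact (hg k).monotone_product (hg' k) hγ.length_pos hαl hM.bound hM'.bound hdisj
    (hlogle.trans_lt hS1) hS1 hlogle

end ConeACF

theorem mainTheorem8 {n : ℕ} (γ : ℝ → EuclideanSpace ℝ (Fin n)) (l α : ℝ)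
    (hγ : ConeACF.IsConeGenerator γ l) (hl : l ≤ 2 * Real.pi)
    (hα : 0 < α) (hαl : α ≤ 4 * Real.pi / l)
    (u v : EuclideanSpace ℝ (Fin n) → ℝ)
    (hu : ContinuousOn u (ConeACF.coneBall γ 1)) (hv : ContinuousOn v (ConeACF.coneBall γ 1))
    (hu0 : ∀ x ∈ ConeACF.coneBall γ 1, 0 ≤ u x) (hv0 : ∀ x ∈ ConeACF.coneBall γ 1, 0 ≤ v x)
    (hus : ConeACF.IsSubharmonic γ l u) (hvs : ConeACF.IsSubharmonic γ l v)
    (huv : ∀ x ∈ ConeACF.coneBall γ 1, u x * v x = 0) :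
    ConeACF.HasLocallyFiniteEnergy γ l u ∧ ConeACF.HasLocallyFiniteEnergy γ l v ∧
      MonotoneOn (ConeACF.acf γ l α u v) (Set.Ioo 0 1) := by
  exact ⟨ConeACF.hasLocallyFiniteEnergy_of_isSubharmonic hγ hu hu0 hus,
    ConeACF.hasLocallyFiniteEnergy_of_isSubharmonic hγ hv hv0 hvs,
    ConeACF.monotoneOn_acf hγ hαl hu hv hu0 hv0 hus hvs huv⟩
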